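/- Let $v\in(1/2,1)$ and consider on $\mathbb R^5\ni(\Sigma_+,\Sigma_-,N_1,N_2,N_3)$ the system \begin{align*} \Sigma_+' &= 4v(1-\Sigma^2)\Sigma_+ + 2\left[(N_3-N_2)^2-N_1(2N_1-N_2-N_3)\right],\\ \Sigma_-' &= 4v(1-\Sigma^2)\Sigma_- + 2\sqrt3\,(N_3-N_2)(N_1-N_2-N_3),\\ N_1' &= -2(2v\Sigma^2-2\Sigma_+)N_1,\\ N_2' &= -2(2v\Sigma^2+\Sigma_++\sqrt3\,\Sigma_-)N_2,\\ N_3' &= -2(2v\Sigma^2+\Sigma_+-\sqrt3\,\Sigma_-)N_3, \end{align*} where $\Sigma^2:=\Sigma_+^2+\Sigma_-^2$, subject to the constraint $$1=\Sigma^2+N_1^2+N_2^2+N_3^2-2N_1N_2-2N_2N_3-2N_3N_1 .$$ The point $$p_{\mathrm{VI}_0}=\left(-\tfrac1{2v},\,0,\,0,\,\tfrac{\sqrt{4v^2-1}}{4v},\,-\tfrac{\sqrt{4v^2-1}}{4v}\right)$$ satisfies the constraint and is an equilibrium. The vector $$e_{ss}=\left(0,\,1,\,\tfrac{8v^2+1}{\sqrt{3(4v^2-1)}},\,\tfrac{\sqrt{3(4v^2-1)}}{6},\,\tfrac{\sqrt{3(4v^2-1)}}{6}\right)$$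 is an eigenvector of the linearization of the system at $p_{\mathrm{VI}_0}$, with eigenvalue $\lambda_{ss}=-3/v$. Let $W^{ss}(p_{\mathrm{VI}_0})$ be the strong-stable manifold of $p_{\mathrm{VI}_0}$ for the constrained flow, that is, the set of initial values $x(0)$ of solutions $x:[0,\infty)\to\mathbb R^5$ of the system that satisfy the constraint and $x(t)-p_{\mathrm{VI}_0}=O(e^{\lambda_{ss}t})$ as $t\to\infty$. Then $W^{ss}(p_{\mathrm{VI}_0})$ is a one-dimensional embedded $C^\infty$ submanifold of $\mathbb R^5$, and it coincides with the set of initial values of all constrained solutions on $[0,\infty)$ that converge to $p_{\mathrm{VI}_0}$. Moreover, in some open neighbourhood of $p_{\mathrm{VI}_0}$ it is the graph of a $C^\infty$ function $\Sigma_-\mapsto(\Sigma_+,N_1,N_2,N_3)$ defined on an interval $(-\delta,\delta)$, $\delta>0$. This graph passes through $p_{\mathrm{VI}_0}$ at $\Sigma_-=0$, is tangent there to $e_{ss}$, and satisfies, as $\Sigma_-\to0$, \begin{align*} \Sigma_+ &= -\frac1{2v}+0\cdot\Sigma_-+O(\Sigma_-^2), & N_1 &= \frac{8v^2+1}{\sqrt{3(4v^2-1)}}\,\Sigma_-+O(\Sigma_-^2),\\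 N_2 &= \frac{\sqrt{4v^2-1}}{4v}+\frac{\sqrt{3(4v^2-1)}}{6}\,\Sigma_-+O(\Sigma_-^2), & N_3 &= -\frac{\sqrt{4v^2-1}}{4v}+\frac{\sqrt{3(4v^2-1)}}{6}\,\Sigma_-+O(\Sigma_-^2). \end{align*} -/

import Mathlib

open Set Filter Topology Asymptotics
open scoped ContDiff

/-- The phase space `ℝ⁵` with coordinates `(Σ₊, Σ₋, N₁, N₂, N₃)`, in this order. -/
abbrev Phase : Type := Fin 5 → ℝ

/-! ### Invariant sets of a constrained flow -/

/-- `x` is a solution of `x' = F x` on the time interval `[0, ∞)` that stays in the constraint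
set `M`. -/
def IsForwardSolution (F : Phase → Phase) (M : Set Phase) (x : ℝ → Phase) : Prop :=
  ∀ t : ℝ, 0 ≤ t → HasDerivWithinAt x (F (x t)) (Ici 0) t ∧ x t ∈ M

/-- The stable set of `p`: initial values of constrained solutions that converge to `p`. -/
def stableSet (F : Phase → Phase) (M : Set Phase) (p : Phase) : Set Phase :=
  {q | ∃ x : ℝ → Phase, IsForwardSolution F M x ∧ x 0 = q ∧ Tendsto x atTop (𝓝 p)}

/-- The strong-stable set of `p` for the rate `r < 0`: initial values of constrained solutions
that converge to `p` at the exponential rate `exp (r t)`. -/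
def strongStableSet (F : Phase → Phase) (M : Set Phase) (p : Phase) (r : ℝ) : Set Phase :=
  {q | ∃ x : ℝ → Phase, IsForwardSolution F M x ∧ x 0 = q ∧
    (fun t => x t - p) =O[atTop] (fun t : ℝ => Real.exp (r * t))}

/-- `W` is a one-dimensional embedded `C^∞` submanifold of `ℝ⁵`: near each of its points it is
the homeomorphic image of an open interval under a `C^∞` map with nowhere vanishing derivative. -/
def IsOneDimSubmanifold (W : Set Phase) : Prop :=
  ∀ q ∈ W, ∃ V : Set Phase, IsOpen V ∧ q ∈ V ∧ ∃ c : ℝ → Phase,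
    ContDiffOn ℝ ∞ c (Ioo (-1) 1) ∧
    (∀ t ∈ Ioo (-1 : ℝ) 1, deriv c t ≠ 0) ∧
    IsEmbedding ((Ioo (-1 : ℝ) 1).domRestrict c) ∧
    c '' Ioo (-1) 1 = W ∩ V

/-! ### The Bianchi class A system -/

namespace Bianchi

/-- `Σ² = Σ₊² + Σ₋²`. -/
def sigmaSq (x : Phase) : ℝ := x 0 ^ 2 + x 1 ^ 2

/-- The curvature term `𝒮₊`. -/
def curvPlus (x : Phase) : ℝ :=
  2 * ((x 4 - x 3) ^ 2 - x 2 * (2 * x 2 - x 3 - x 4))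

/-- The curvature term `𝒮₋`. -/
noncomputable def curvMinus (x : Phase) : ℝ :=
  2 * √3 * (x 4 - x 3) * (x 2 - x 3 - x 4)

/-- The right-hand side of the evolution equations for `(Σ₊, Σ₋, N₁, N₂, N₃)`. -/
noncomputable def field (v : ℝ) (x : Phase) : Phase :=
  ![4 * v * (1 - sigmaSq x) * x 0 + curvPlus x,
    4 * v * (1 - sigmaSq x) * x 1 + curvMinus x,
    -2 * (2 * v * sigmaSq x - 2 * x 0) * x 2,
    -2 * (2 * v * sigmaSq x + x 0 + √3 * x 1) * x 3,
    -2 * (2 * v * sigmaSq x + x 0 - √3 * x 1) * x 4]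

/-- The constraint set
`1 = Σ² + N₁² + N₂² + N₃² - 2 N₁ N₂ - 2 N₂ N₃ - 2 N₃ N₁`. -/
def constraintSet : Set Phase :=
  {x | 1 = sigmaSq x + x 2 ^ 2 + x 3 ^ 2 + x 4 ^ 2
      - 2 * x 2 * x 3 - 2 * x 3 * x 4 - 2 * x 4 * x 2}

/-- The type `VI₀` equilibrium, with `N₁ = 0`. -/
noncomputable def pVI (v : ℝ) : Phase :=
  ![-(1 / (2 * v)), 0, 0, √(4 * v ^ 2 - 1) / (4 * v), -(√(4 * v ^ 2 - 1) / (4 * v))]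

/-- The strong-stable eigenvalue. -/
noncomputable def lamSS (v : ℝ) : ℝ := -(3 / v)

/-- The strong-stable eigenvector. -/
noncomputable def eSS (v : ℝ) : Phase :=
  ![0, 1, (8 * v ^ 2 + 1) / √(3 * (4 * v ^ 2 - 1)),
    √(3 * (4 * v ^ 2 - 1)) / 6, √(3 * (4 * v ^ 2 - 1)) / 6]

/-- The strong-stable manifold of the equilibrium `pVI v` for the constrained flow. -/
noncomputable def Wss (v : ℝ) : Set Phase :=
  strongStableSet (field v) constraintSet (pVI v) (lamSS v)

end Bianchi

/-!
The linearization of the field at `pVI v` has the eigenvalues `-3/v` (along `eSS v`), `-2/v`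
(transverse to the constraint set), `(4 v² - 1)/v`, and a complex pair with real part
`(4 v² - 1)/(2 v)`. On the constraint set the equilibrium is therefore a saddle with a
one-dimensional stable direction, and the claim splits into a local and a global part.

**The local curve.** The field is cubic, `-3/v` is the least eigenvalue, and hence no multiple
`k · (-3/v)` with `k ≥ 2` is an eigenvalue. A power series `h` with `h 0 = pVI v`, `h' 0 = eSS v`
and `λ s h' s = F (h s)` is therefore determined by a recursion whose inverses are uniformly
bounded, and it converges near `0` (`exists_invariantCurve`). The defect of the constraint satisfies
`s γ' = (2/3 + o(1)) γ` along `h`, which forces `γ = 0` (`eq_zero_of_mul_deriv_eq`). The flow on the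
curve is `s ↦ s exp (λ t)`, so the curve lies in the strong-stable set. As the `Σ₋`-component of
`eSS v` is `1`, the curve is a graph `c` over `Σ₋` (`exists_graph_curve`).

**Every converging solution lies on it eventually.** For a constrained solution `x` that converges
to the equilibrium, let `d = x - c (x 1)`. Three linear functionals that vanish on `eSS v` span the
unstable left eigenspace. An explicit positive definite quadratic form in them grows under the
linearized flow, and near the equilibrium it controls `d`, since the constraint bounds the remaining
component. So this form cannot decrease along `x`; it tends to zero and hence vanishes
(`eventually_mem_curve`). By the explicit flow on the curve, the stable and the strong-stable set
coincide.

**Embeddedness.** The product `D = N₁ N₂ N₃` satisfies `D' = -12 v Σ² D`, so its absolute value is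
strictly decreasing along constrained solutions on which it does not vanish (`prodN_strict`); it is
stationary only where `Σ₊ = Σ₋ = 0`, which cannot persist on the constraint set. It has a nonzero
derivative along `eSS v`. It follows that it is injective on the stable set: two solutions starting
with the same value merge on the local curve, and on a common orbit the value determines the point
(`IsLocalStableCurve.injOn_prodN`). A set on which a continuous function is injective, and which
contains through each point a regular curve along which that function is strictly monotone, is an
embedded curve (`isOneDimSubmanifold_of_injOn`); slabs between level sets of the function serve as
the open sets of the charts, and also as the neighbourhood in which the set is a graph.
-/

/-! ### Power series with vector coefficients -/

section PowerSeries

variable {E F G : Type*} [NormedAddCommGroup E] [NormedSpace ℝ E]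
  [NormedAddCommGroup F] [NormedSpace ℝ F] [NormedAddCommGroup G] [NormedSpace ℝ G]

/-- The Cauchy product of two coefficient sequences with respect to a bilinear map. -/
noncomputable def cauchyProd (B : E →L[ℝ] F →L[ℝ] G) (f : ℕ → E) (g : ℕ → F) (k : ℕ) : G :=
  ∑ ij ∈ Finset.HasAntidiagonal.antidiagonal k, B (f ij.1) (g ij.2)

theorem cauchyProd_congr (B : E →L[ℝ] F →L[ℝ] G) {f f' : ℕ → E} {g g' : ℕ → F} {k : ℕ}
    (hf : ∀ i ≤ k, f i = f' i) (hg : ∀ i ≤ k, g i = g' i) :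
    cauchyProd B f g k = cauchyProd B f' g' k := by
  refine Finset.sum_congr rfl fun ij hij => ?_
  have := Finset.HasAntidiagonal.mem_antidiagonal.1 hij
  rw [hf _ (by omega), hg _ (by omega)]

theorem sum_range_antidiagonal_le {f g : ℕ → ℝ} (hf : ∀ n, 0 ≤ f n) (hg : ∀ n, 0 ≤ g n) (N : ℕ) :
    ∑ k ∈ Finset.range N, ∑ ij ∈ Finset.HasAntidiagonal.antidiagonal k, f ij.1 * g ij.2 ≤
      (∑ i ∈ Finset.range N, f i) * ∑ j ∈ Finset.range N, g j := by
  rw [Finset.sum_mul_sum, ← Finset.sum_product', Finset.sum_sigma']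
  rw [← Finset.sum_image (f := fun ij : ℕ × ℕ => f ij.1 * g ij.2)
    (g := fun x : (_ : ℕ) × ℕ × ℕ => x.2)]
  · refine Finset.sum_le_sum_of_subset_of_nonneg (fun ij hij => ?_)
      fun ij _ _ => mul_nonneg (hf _) (hg _)
    simp only [Finset.mem_image, Finset.mem_sigma, Finset.mem_range,
      Finset.HasAntidiagonal.mem_antidiagonal] at hij
    obtain ⟨x, ⟨h1, h2⟩, rfl⟩ := hij
    simp only [Finset.mem_product, Finset.mem_range]
    omega
  · rintro ⟨k, ij⟩ hx ⟨l, ij'⟩ hy h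
    simp only [Finset.coe_sigma, Set.mem_sigma_iff, Finset.mem_coe,
      Finset.HasAntidiagonal.mem_antidiagonal] at hx hy h
    subst h
    obtain rfl : k = l := hx.2.symm.trans hy.2
    rfl

theorem sum_norm_cauchyProd_le (B : E →L[ℝ] F →L[ℝ] G) (f : ℕ → E) (g : ℕ → F) {r : ℝ}
    (hr : 0 ≤ r) (N : ℕ) :
    ∑ k ∈ Finset.range N, ‖cauchyProd B f g k‖ * r ^ k ≤
      ‖B‖ * ((∑ k ∈ Finset.range N, ‖f k‖ * r ^ k) * ∑ k ∈ Finset.range N, ‖g k‖ * r ^ k) := by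
  refine le_trans ?_ (mul_le_mul_of_nonneg_left (sum_range_antidiagonal_le
    (fun n => by positivity) (fun n => by positivity) N) (norm_nonneg B))
  rw [Finset.mul_sum]
  refine Finset.sum_le_sum fun k _ => ?_
  rw [Finset.mul_sum]
  refine (mul_le_mul_of_nonneg_right (norm_sum_le _ _) (by positivity)).trans ?_
  rw [Finset.sum_mul]
  refine Finset.sum_le_sum fun ij hij => ?_
  rw [← Finset.HasAntidiagonal.mem_antidiagonal.1 hij, pow_add]
  calc ‖B (f ij.1) (g ij.2)‖ * (r ^ ij.1 * r ^ ij.2)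
      ≤ (‖B‖ * ‖f ij.1‖ * ‖g ij.2‖) * (r ^ ij.1 * r ^ ij.2) := by
        gcongr; exact B.le_opNorm₂ _ _
    _ = _ := by ring

theorem summable_norm_cauchyProd (B : E →L[ℝ] F →L[ℝ] G) {f : ℕ → E} {g : ℕ → F} {r : ℝ}
    (hr : 0 ≤ r) (hf : Summable fun k => ‖f k‖ * r ^ k) (hg : Summable fun k => ‖g k‖ * r ^ k) :
    Summable fun k => ‖cauchyProd B f g k‖ * r ^ k := by
  refine summable_of_sum_range_le (fun n => by positivity) fun N =>
    (sum_norm_cauchyProd_le B f g hr N).trans (mul_le_mul_of_nonneg_left (mul_le_mul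
      (hf.sum_le_tsum _ fun _ _ => by positivity) (hg.sum_le_tsum _ fun _ _ => by positivity)
      (Finset.sum_nonneg fun _ _ => by positivity) (tsum_nonneg fun _ => by positivity))
      (norm_nonneg B))

theorem summable_smul_of_abs_le [CompleteSpace E] {f : ℕ → E} {r s : ℝ} (hs : |s| ≤ r)
    (hf : Summable fun k => ‖f k‖ * r ^ k) : Summable fun k => s ^ k • f k := by
  refine Summable.of_norm_bounded hf fun k => ?_
  rw [norm_smul, norm_pow, Real.norm_eq_abs, mul_comm]
  gcongr

/-- The sum of the Cauchy product is the bilinear map applied to the sums. -/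
theorem tsum_cauchyProd [CompleteSpace E] [CompleteSpace F] [CompleteSpace G]
    (B : E →L[ℝ] F →L[ℝ] G) {f : ℕ → E} {g : ℕ → F} {r s : ℝ} (hs : |s| ≤ r)
    (hf : Summable fun k => ‖f k‖ * r ^ k) (hg : Summable fun k => ‖g k‖ * r ^ k) :
    ∑' k, s ^ k • cauchyProd B f g k = B (∑' k, s ^ k • f k) (∑' k, s ^ k • g k) := by
  have hr : 0 ≤ r := (abs_nonneg s).trans hs
  have hF := summable_smul_of_abs_le hs hf
  have hG := summable_smul_of_abs_le hs hg
  have hsum : Summable fun ij : ℕ × ℕ => B (s ^ ij.1 • f ij.1) (s ^ ij.2 • g ij.2) := by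
    refine Summable.of_norm_bounded ((hf.mul_of_nonneg hg (fun _ => by positivity)
      (fun _ => by positivity)).mul_left ‖B‖) fun ij => ?_
    refine (B.le_opNorm₂ _ _).trans ?_
    rw [mul_assoc]
    refine mul_le_mul_of_nonneg_left (mul_le_mul ?_ ?_ (norm_nonneg _) (by positivity))
      (norm_nonneg B) <;>
    · rw [norm_smul, norm_pow, Real.norm_eq_abs, mul_comm]
      gcongr
  have h1 : B (∑' k, s ^ k • f k) (∑' k, s ^ k • g k)
      = ∑' ij : ℕ × ℕ, B (s ^ ij.1 • f ij.1) (s ^ ij.2 • g ij.2) := by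
    rw [hsum.tsum_prod, B.map_tsum hF]
    have hBF : Summable fun k => B (s ^ k • f k) := hF.map B B.continuous
    rw [show (∑' k, B (s ^ k • f k)) (∑' k, s ^ k • g k)
      = ContinuousLinearMap.apply ℝ G (∑' k, s ^ k • g k) (∑' k, B (s ^ k • f k)) from rfl,
      ContinuousLinearMap.map_tsum _ hBF]
    refine tsum_congr fun i => ?_
    exact (B (s ^ i • f i)).map_tsum hG
  rw [h1, ← (Finset.HasAntidiagonal.sigmaAntidiagonalEquivProd (A := ℕ)).tsum_eq]
  have hsig := ((Finset.HasAntidiagonal.sigmaAntidiagonalEquivProd (A := ℕ)).summable_iff.2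
    hsum).tsum_sigma' (fun k => (hasSum_fintype _).summable)
  simp only [Function.comp_def] at hsig
  rw [hsig]
  refine tsum_congr fun k => ?_
  rw [tsum_fintype, cauchyProd, Finset.smul_sum, ← Finset.sum_coe_sort]
  refine Finset.sum_congr rfl fun ij _ => ?_
  have := Finset.HasAntidiagonal.mem_antidiagonal.1 ij.2
  simp only [Finset.HasAntidiagonal.sigmaAntidiagonalEquivProd_apply, map_smul, _root_.smul_apply]
  rw [smul_smul, ← pow_add, add_comm, this]

/-- A sequence may be defined by recursion over its own truncations. -/
theorem exists_seq_eq_of_truncation {E : Type*} [Zero E] (Φ : ℕ → (ℕ → E) → E) :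
    ∃ a : ℕ → E, ∀ k, a k = Φ k fun m => if m < k then a m else 0 := by
  refine ⟨WellFounded.fix Nat.lt_wfRel.wf
    fun k ih => Φ k fun m => if h : m < k then ih m h else 0, fun k => ?_⟩
  rw [WellFounded.fix_eq]
  rfl

/-- A vector-valued power series is smooth inside its disc of convergence. -/
theorem contDiffOn_tsum_pow_smul [CompleteSpace E] {a : ℕ → E} {r : ℝ} (hr : 0 < r)
    (ha : Summable fun k => ‖a k‖ * r ^ k) :
    ContDiffOn ℝ ∞ (fun s : ℝ => ∑' k, s ^ k • a k) (Ioo (-r) r) := by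
  let p : FormalMultilinearSeries ℝ ℝ E := fun k =>
    ContinuousMultilinearMap.mkPiRing ℝ (Fin k) (a k)
  have hrad : ENNReal.ofReal r ≤ p.radius := by
    refine p.le_radius_of_summable (r := r.toNNReal) ?_
    simpa [p, ContinuousMultilinearMap.norm_mkPiRing, Real.coe_toNNReal r hr.le] using ha
  have hp := p.hasFPowerSeriesOnBall ((ENNReal.ofReal_pos.2 hr).trans_le hrad)
  have hsum : p.sum = fun s : ℝ => ∑' k, s ^ k • a k := by
    funext s
    simp [FormalMultilinearSeries.sum, p]
  rw [hsum] at hp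
  refine (hp.analyticOnNhd.contDiffOn Metric.isOpen_eball.uniqueDiffOn).mono fun s hs => ?_
  rw [Metric.mem_eball, edist_zero_right]
  refine lt_of_lt_of_le ?_ hrad
  rw [← ofReal_norm]
  exact (ENNReal.ofReal_lt_ofReal_iff hr).2 (abs_lt.2 hs)

theorem hasDerivAt_tsum_pow_smul [CompleteSpace E] {a : ℕ → E} {r s : ℝ} (hs : |s| < r)
    (ha : Summable fun k : ℕ => (k : ℝ) * ‖a k‖ * r ^ (k - 1)) :
    HasDerivAt (fun s : ℝ => ∑' k, s ^ k • a k) (∑' k : ℕ, ((k : ℝ) * s ^ (k - 1)) • a k) s := by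
  have hr : 0 < r := (abs_nonneg s).trans_lt hs
  refine hasDerivAt_tsum_of_isPreconnected (t := Ioo (-r) r) (y₀ := 0) ha isOpen_Ioo
    isPreconnected_Ioo (fun n y _ => (hasDerivAt_pow n y).smul_const (a n)) (fun n y hy => ?_)
    ⟨by linarith, hr⟩ ?_ (abs_lt.1 hs)
  · rw [norm_smul, norm_mul, norm_pow, Real.norm_eq_abs, Real.norm_eq_abs, Nat.abs_cast]
    have := abs_lt.2 hy
    calc (n : ℝ) * |y| ^ (n - 1) * ‖a n‖ ≤ (n : ℝ) * r ^ (n - 1) * ‖a n‖ := by gcongr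
      _ = _ := by ring
  · refine summable_of_ne_finset_zero (s := {0}) fun k hk => ?_
    rw [zero_pow (by simpa using hk), zero_smul]

/-- If no `k λ` with `k ≥ 2` is a spectral value of `A`, the inverses of `k λ - A` are bounded
uniformly in `k ≥ 2`. -/
theorem exists_norm_inverse_natCast_mul_sub_le [CompleteSpace E] (A : E →L[ℝ] E) {l : ℝ}
    (hl : l ≠ 0) (hA : ∀ k : ℕ, IsUnit ((((k : ℝ) + 2) * l) • (1 : E →L[ℝ] E) - A)) :
    ∃ (C : ℝ) (R : ℕ → E →L[ℝ] E), 0 ≤ C ∧ ∀ k, ‖R k‖ ≤ C ∧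
      ∀ x, (((k : ℝ) + 2) * l) • R k x - A (R k x) = x := by
  have hlim : Tendsto (fun k : ℕ => ‖resolvent A (((k : ℝ) + 2) * l)‖) atTop
      (𝓝 ‖(0 : E →L[ℝ] E)‖) := by
    refine ((spectrum.resolvent_tendsto_cobounded A).comp ?_).norm
    rw [← tendsto_norm_atTop_iff_cobounded]
    simp only [norm_mul]
    refine Tendsto.atTop_mul_const (norm_pos_iff.2 hl) ?_
    refine tendsto_norm_atTop_atTop.comp ?_
    exact tendsto_atTop_add_const_right _ _ tendsto_natCast_atTop_atTop
  obtain ⟨C, hC⟩ := hlim.bddAbove_range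
  refine ⟨C, fun k => resolvent A (((k : ℝ) + 2) * l),
    (norm_nonneg _).trans (hC ⟨0, rfl⟩), fun k => ⟨hC ⟨k, rfl⟩, fun x => ?_⟩⟩
  have h := Ring.mul_inverse_cancel _ (hA k)
  have h2 := congrArg (fun L : E →L[ℝ] E => L x) h
  simpa [resolvent, Algebra.algebraMap_eq_smul_one] using h2

/-- The recursion for the coefficients of an invariant curve, in terms of the quotient of the curve
by its parameter. -/
theorem exists_coeff_invariantCurve (R : ℕ → E →L[ℝ] E) (B : E →L[ℝ] E →L[ℝ] E)
    (Q : E →L[ℝ] E →L[ℝ] F) (P : F →L[ℝ] E →L[ℝ] E) (e : E) :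
    ∃ a b : ℕ → E, a 0 = 0 ∧ (∀ k, a (k + 1) = b k) ∧ b 0 = e ∧
      ∀ k, b (k + 1) = R k (cauchyProd B b b k +
        cauchyProd P (cauchyProd Q b b) a k) := by
  let sh : (ℕ → E) → ℕ → E := fun b k => Nat.casesOn k 0 b
  obtain ⟨b, hb⟩ := exists_seq_eq_of_truncation (E := E) fun k b => Nat.casesOn k e fun k =>
    R k (cauchyProd B b b k + cauchyProd P (cauchyProd Q b b) (sh b) k)
  refine ⟨sh b, b, rfl, fun _ => rfl, hb 0, fun k => ?_⟩
  have htr : ∀ i ≤ k, (if i < k + 1 then b i else 0) = b i := fun i hi => if_pos (by omega)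
  refine (hb (k + 1)).trans (congrArg (R k) (congrArg₂ (· + ·) (cauchyProd_congr B htr htr)
    (cauchyProd_congr _ (fun i hi => cauchyProd_congr Q (fun j hj => htr j (hj.trans hi))
      fun j hj => htr j (hj.trans hi)) fun i hi => ?_)))
  cases i with
  | zero => rfl
  | succ i => exact htr i (by omega)

/-- **Poincaré's linearization on a non-resonant eigenline.** Let `l` be an eigenvalue of the
linear part of a cubic vector field such that no multiple `k l` with `k ≥ 2` is a spectral value.
Then the vector field has a smooth invariant curve tangent to the eigenvector, parametrized so that
the induced flow on it is linear. The coefficients of the parametrization solve a recursion whose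
small divisors `k l - A` have uniformly bounded inverses, so that the partial sums of the
majorant series stay bounded on a small disc. -/
theorem exists_invariantCurve [CompleteSpace E] [CompleteSpace F] (A : E →L[ℝ] E)
    (B : E →L[ℝ] E →L[ℝ] E) (Q : E →L[ℝ] E →L[ℝ] F) (P : F →L[ℝ] E →L[ℝ] E) {l : ℝ}
    (hl : l ≠ 0) {e : E} (he : A e = l • e)
    (hA : ∀ k : ℕ, IsUnit ((((k : ℝ) + 2) * l) • (1 : E →L[ℝ] E) - A)) :
    ∃ (r : ℝ) (h : ℝ → E), 0 < r ∧ ContDiffOn ℝ ∞ h (Ioo (-r) r) ∧ h 0 = 0 ∧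
      HasDerivAt h e 0 ∧ ∀ s ∈ Ioo (-r) r, ∃ h' : E, HasDerivAt h h' s ∧
        (l * s) • h' = A (h s) + B (h s) (h s) + P (Q (h s) (h s)) (h s) := by
  obtain ⟨C, R, hC, hR⟩ := exists_norm_inverse_natCast_mul_sub_le A hl hA
  obtain ⟨a, b, ha0, hab, hb0, hb⟩ := exists_coeff_invariantCurve R B Q P e
  set d : ℕ → E := fun k => cauchyProd B b b k +
        cauchyProd P (cauchyProd Q b b) a k with hd
  -- the partial sums of the majorant series stay below `S` on a disc of radius `r`
  set S : ℝ := ‖e‖ + 1 with hS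
  have hS0 : 0 < S := by positivity
  obtain ⟨r, hr0, hr⟩ : ∃ r : ℝ, 0 < r ∧
      r * (C * (‖B‖ * S ^ 2) + r * (C * (‖P‖ * ‖Q‖ * S ^ 3))) ≤ 1 := by
    have : Tendsto (fun r : ℝ => r * (C * (‖B‖ * S ^ 2) + r * (C * (‖P‖ * ‖Q‖ * S ^ 3)))) (𝓝[>] 0)
        (𝓝 (0 * (C * (‖B‖ * S ^ 2) + 0 * (C * (‖P‖ * ‖Q‖ * S ^ 3))))) := by
      refine (Continuous.tendsto ?_ 0).mono_left nhdsWithin_le_nhds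
      fun_prop
    rw [zero_mul] at this
    obtain ⟨r, h1, h2⟩ := ((this.eventually_lt_const one_pos).and self_mem_nhdsWithin).exists
    exact ⟨r, h2, h1.le⟩
  have hsum_a : ∀ N, ∑ k ∈ Finset.range (N + 1), ‖a k‖ * r ^ k
      = r * ∑ k ∈ Finset.range N, ‖b k‖ * r ^ k := by
    intro N
    rw [Finset.sum_range_succ', ha0, norm_zero, zero_mul, add_zero, Finset.mul_sum]
    exact Finset.sum_congr rfl fun k _ => by rw [hab, pow_succ]; ring
  have hbound : ∀ N, ∑ k ∈ Finset.range N, ‖b k‖ * r ^ k ≤ S := by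
    intro N
    induction N with
    | zero => simpa using hS0.le
    | succ N ih =>
      set σ := ∑ k ∈ Finset.range N, ‖b k‖ * r ^ k with hσ
      have hσ0 : 0 ≤ σ := Finset.sum_nonneg fun _ _ => by positivity
      have ha : ∑ k ∈ Finset.range N, ‖a k‖ * r ^ k ≤ r * σ := by
        rw [← hsum_a, Finset.sum_range_succ]
        exact le_add_of_nonneg_right (by positivity)
      have hB := sum_norm_cauchyProd_le B b b hr0.le N
      have hT := sum_norm_cauchyProd_le Q b b hr0.le N
      have hI := sum_norm_cauchyProd_le P (cauchyProd Q b b) a hr0.le N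
      have hd' : ∑ k ∈ Finset.range N, ‖d k‖ * r ^ k ≤ ‖B‖ * S ^ 2 + r * (‖P‖ * ‖Q‖ * S ^ 3) := by
        calc ∑ k ∈ Finset.range N, ‖d k‖ * r ^ k
            ≤ ∑ k ∈ Finset.range N, (‖cauchyProd B b b k‖ * r ^ k +
              ‖cauchyProd P (cauchyProd Q b b) a k‖ * r ^ k) := by
              refine Finset.sum_le_sum fun k _ => ?_
              rw [← add_mul]
              gcongr
              exact norm_add_le _ _
          _ ≤ ‖B‖ * (σ * σ) + ‖P‖ * ((‖Q‖ * (σ * σ)) * (r * σ)) := by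
              rw [Finset.sum_add_distrib]
              refine add_le_add hB (hI.trans ?_)
              refine mul_le_mul_of_nonneg_left ?_ (norm_nonneg P)
              exact mul_le_mul hT ha (Finset.sum_nonneg fun _ _ => by positivity) (by positivity)
          _ ≤ ‖B‖ * (S * S) + ‖P‖ * ((‖Q‖ * (S * S)) * (r * S)) := by gcongr
          _ = _ := by ring
      rw [Finset.sum_range_succ']
      have : ∑ k ∈ Finset.range N, ‖b (k + 1)‖ * r ^ (k + 1) ≤
          r * (C * ∑ k ∈ Finset.range N, ‖d k‖ * r ^ k) := by
        rw [Finset.mul_sum, Finset.mul_sum]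
        refine Finset.sum_le_sum fun k _ => ?_
        rw [hb k]
        calc ‖R k (d k)‖ * r ^ (k + 1) ≤ (C * ‖d k‖) * r ^ (k + 1) := by
              gcongr
              exact (R k).le_of_opNorm_le (hR k).1 _
          _ = _ := by rw [pow_succ]; ring
      rw [hb0, pow_zero, mul_one, hS, add_comm]
      gcongr
      calc _ ≤ _ := this
        _ ≤ r * (C * (‖B‖ * S ^ 2 + r * (‖P‖ * ‖Q‖ * S ^ 3))) := by gcongr
        _ = _ := by ring
        _ ≤ 1 := hr
  have hbs : Summable fun k => ‖b k‖ * r ^ k :=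
    summable_of_sum_range_le (fun _ => by positivity) hbound
  have has : Summable fun k => ‖a k‖ * r ^ k := by
    rw [← summable_nat_add_iff 1]
    refine (hbs.mul_left r).congr fun k => ?_
    rw [hab, pow_succ]; ring
  have has' : Summable fun k : ℕ => (k : ℝ) * ‖a k‖ * (r / 2) ^ (k - 1) := by
    rw [← summable_nat_add_iff 1]
    refine Summable.of_nonneg_of_le (fun k => by positivity) (fun k => ?_) (hbs.mul_left 2)
    rw [hab, Nat.add_sub_cancel, div_pow]
    have h2 : ((k + 1 : ℕ) : ℝ) ≤ 2 * 2 ^ k := by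
      have : k + 1 ≤ 2 ^ (k + 1) := (Nat.lt_two_pow_self).le
      rw [pow_succ, mul_comm] at this
      exact_mod_cast this
    calc ((k + 1 : ℕ) : ℝ) * ‖b k‖ * (r ^ k / 2 ^ k)
        = ((k + 1 : ℕ) : ℝ) * (‖b k‖ * r ^ k / 2 ^ k) := by ring
      _ ≤ (2 * 2 ^ k) * (‖b k‖ * r ^ k / 2 ^ k) := by gcongr
      _ = _ := by field_simp
  have hr2 : 0 < r / 2 := by positivity
  refine ⟨r / 2, fun s => ∑' k, s ^ k • a k, hr2,
    (contDiffOn_tsum_pow_smul hr0 has).mono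
      (Ioo_subset_Ioo (by linarith) (by linarith)), ?_, ?_, ?_⟩
  · beta_reduce
    rw [tsum_eq_single 0 fun k hk => by rw [zero_pow hk, zero_smul], ha0, smul_zero]
  · have h := hasDerivAt_tsum_pow_smul (s := 0) (by simpa using hr2) has'
    rwa [tsum_eq_single 1 fun k hk => ?_, hab, hb0, Nat.cast_one, one_mul, Nat.sub_self, pow_zero,
      one_smul] at h
    rcases Nat.eq_zero_or_pos k with rfl | hk0
    · simp
    · rw [zero_pow (by omega), mul_zero, zero_smul]
  · intro s hs
    have hs' := abs_lt.2 hs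
    have hsr : |s| ≤ r := hs'.le.trans (by linarith)
    refine ⟨_, hasDerivAt_tsum_pow_smul hs' has', ?_⟩
    have hcT := summable_norm_cauchyProd Q hr0.le hbs hbs
    have hcI := summable_norm_cauchyProd P hr0.le hcT has
    have hcB := summable_norm_cauchyProd B hr0.le hbs hbs
    have hdsum : ∑' k, s ^ k • d k = B (∑' k, s ^ k • b k) (∑' k, s ^ k • b k) +
        P (Q (∑' k, s ^ k • b k) (∑' k, s ^ k • b k)) (∑' k, s ^ k • a k) := by
      simp only [hd, smul_add]
      rw [(summable_smul_of_abs_le hsr hcB).tsum_add (summable_smul_of_abs_le hsr hcI),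
        tsum_cauchyProd B hsr hbs hbs, tsum_cauchyProd _ hsr hcT has,
        tsum_cauchyProd Q hsr hbs hbs]
    have hds : Summable fun k => s ^ k • d k := by
      simp only [hd, smul_add]
      exact (summable_smul_of_abs_le hsr hcB).add (summable_smul_of_abs_le hsr hcI)
    have hbsum := summable_smul_of_abs_le hsr hbs
    set w := ∑' k, s ^ k • b k with hw
    have hasum : ∑' k, s ^ k • a k = s • w := by
      rw [(summable_smul_of_abs_le hsr has).tsum_eq_zero_add, ha0, smul_zero, zero_add, hw,
        ← hbsum.tsum_const_smul]
      refine tsum_congr fun k => ?_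
      rw [hab, pow_succ', mul_smul]
    -- termwise comparison of the two sides
    have hder : (l • ∑' k : ℕ, ((k : ℝ) * s ^ (k - 1)) • a k) = A w + s • ∑' k, s ^ k • d k := by
      have hsm : Summable fun k : ℕ => ((k : ℝ) * s ^ (k - 1)) • a k := by
        refine Summable.of_norm_bounded has' fun k => ?_
        rw [norm_smul, norm_mul, norm_pow, Real.norm_eq_abs, Real.norm_eq_abs, Nat.abs_cast,
          mul_right_comm]
        gcongr
      have hAb : Summable fun k => s ^ k • A (b k) := by
        simpa [Function.comp_def] using hbsum.map A A.continuous
      have hAw : A w = ∑' k, s ^ k • A (b k) := by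
        rw [hw, A.map_tsum hbsum]; simp
      rw [← hsm.tsum_const_smul, (hsm.const_smul l).tsum_eq_zero_add, hAw,
        ((summable_nat_add_iff 1).2 (hsm.const_smul l)).tsum_eq_zero_add, hAb.tsum_eq_zero_add,
        ← hds.tsum_const_smul, add_assoc,
        ← ((summable_nat_add_iff 1).2 hAb).tsum_add (hds.const_smul s)]
      have h0 : l • (((0 : ℕ) : ℝ) * s ^ (0 - 1)) • a 0 = 0 := by simp
      rw [h0, zero_add]
      congr 1
      · simp [hab, hb0, he]
      · refine tsum_congr fun k => ?_
        have hk := (hR k).2 (d k)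
        rw [← hb k] at hk
        rw [hab, ← smul_assoc s, smul_eq_mul, ← pow_succ', ← smul_add, ← hk, add_sub_cancel]
        simp only [Nat.add_sub_cancel, smul_smul]
        congr 1
        push_cast
        ring
    beta_reduce
    rw [mul_comm, mul_smul, hder, hdsum, hasum]
    simp only [map_smul, _root_.smul_apply, smul_add, smul_smul]
    rw [add_assoc]

end PowerSeries

namespace Bianchi

/-! ### The Taylor expansion of the field at the equilibrium -/

/-- The linearization of the field at `pVI v`. -/
noncomputable def linMap (v : ℝ) : Phase →L[ℝ] Phase :=
  LinearMap.toContinuousLinearMap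
    { toFun := fun u => ![(4 * v - 3 / v) * u 0 + 8 * (√(4 * v ^ 2 - 1) / (4 * v)) * (u 3 - u 4),
        (4 * v - 1 / v) * u 1 - 4 * √3 * (√(4 * v ^ 2 - 1) / (4 * v)) * (u 2 - u 3 - u 4),
        -(3 / v) * u 2,
        2 * (√(4 * v ^ 2 - 1) / (4 * v)) * (u 0 - √3 * u 1),
        -(2 * (√(4 * v ^ 2 - 1) / (4 * v)) * (u 0 + √3 * u 1))]
      map_add' := fun u w => by ext i; fin_cases i <;> simp <;> ring
      map_smul' := fun c u => by ext i; fin_cases i <;> simp <;> ring }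

theorem linMap_apply (v : ℝ) (u : Phase) : linMap v u =
    ![(4 * v - 3 / v) * u 0 + 8 * (√(4 * v ^ 2 - 1) / (4 * v)) * (u 3 - u 4),
        (4 * v - 1 / v) * u 1 - 4 * √3 * (√(4 * v ^ 2 - 1) / (4 * v)) * (u 2 - u 3 - u 4),
        -(3 / v) * u 2,
        2 * (√(4 * v ^ 2 - 1) / (4 * v)) * (u 0 - √3 * u 1),
        -(2 * (√(4 * v ^ 2 - 1) / (4 * v)) * (u 0 + √3 * u 1))] := rfl

/-- The polarization of `sigmaSq`. -/
noncomputable def sigmaForm : Phase →L[ℝ] Phase →L[ℝ] ℝ :=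
  LinearMap.toContinuousBilinearMap
    (LinearMap.mk₂ ℝ (fun u w : Phase => u 0 * w 0 + u 1 * w 1)
      (fun _ _ _ => by simp; ring) (fun _ _ _ => by simp; ring)
      (fun _ _ _ => by simp; ring) (fun _ _ _ => by simp; ring))

theorem sigmaForm_apply (u w : Phase) : sigmaForm u w = u 0 * w 0 + u 1 * w 1 := rfl

/-- The quadratic part of the field at `pVI v`, as a (non-symmetric) bilinear map. -/
noncomputable def quadMap (v : ℝ) : Phase →L[ℝ] Phase →L[ℝ] Phase :=
  LinearMap.toContinuousBilinearMap
    (LinearMap.mk₂ ℝ (fun u w : Phase =>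
        ![2 * (u 0 * w 0 + u 1 * w 1) + 4 * u 0 * w 0
            + 2 * ((u 4 - u 3) * (w 4 - w 3) - u 2 * (2 * w 2 - w 3 - w 4)),
          4 * u 0 * w 1 + 2 * √3 * (u 4 - u 3) * (w 2 - w 3 - w 4),
          8 * u 0 * w 2,
          -(√(4 * v ^ 2 - 1) * (u 0 * w 0 + u 1 * w 1)) + (2 * u 0 - 2 * √3 * u 1) * w 3,
          √(4 * v ^ 2 - 1) * (u 0 * w 0 + u 1 * w 1) + (2 * u 0 + 2 * √3 * u 1) * w 4])
      (fun _ _ _ => by ext i; fin_cases i <;> simp <;> ring)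
      (fun _ _ _ => by ext i; fin_cases i <;> simp <;> ring)
      (fun _ _ _ => by ext i; fin_cases i <;> simp <;> ring)
      (fun _ _ _ => by ext i; fin_cases i <;> simp <;> ring))

theorem quadMap_apply (v : ℝ) (u w : Phase) : quadMap v u w =
        ![2 * (u 0 * w 0 + u 1 * w 1) + 4 * u 0 * w 0
            + 2 * ((u 4 - u 3) * (w 4 - w 3) - u 2 * (2 * w 2 - w 3 - w 4)),
          4 * u 0 * w 1 + 2 * √3 * (u 4 - u 3) * (w 2 - w 3 - w 4),
          8 * u 0 * w 2,
          -(√(4 * v ^ 2 - 1) * (u 0 * w 0 + u 1 * w 1)) + (2 * u 0 - 2 * √3 * u 1) * w 3,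
          √(4 * v ^ 2 - 1) * (u 0 * w 0 + u 1 * w 1) + (2 * u 0 + 2 * √3 * u 1) * w 4] := rfl

variable {v : ℝ}

theorem sqrt_pos_of_mem (hv : v ∈ Ioo (1 / 2 : ℝ) 1) : 0 < √(4 * v ^ 2 - 1) :=
  Real.sqrt_pos.2 (by nlinarith [hv.1])

theorem sq_sqrt_of_mem (hv : v ∈ Ioo (1 / 2 : ℝ) 1) : √(4 * v ^ 2 - 1) ^ 2 = 4 * v ^ 2 - 1 :=
  Real.sq_sqrt (by nlinarith [hv.1])

theorem pos_of_mem (hv : v ∈ Ioo (1 / 2 : ℝ) 1) : 0 < v := by linarith [hv.1]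

theorem sqrt_three_mul (v : ℝ) :
    √(3 * (4 * v ^ 2 - 1)) = √3 * √(4 * v ^ 2 - 1) :=
  Real.sqrt_mul (by norm_num) _

/-- The exact Taylor expansion of the field at the equilibrium; its cubic part is radial. -/
theorem field_pVI_add (hv : v ∈ Ioo (1 / 2 : ℝ) 1) (u : Phase) :
    field v (pVI v + u) = linMap v u + quadMap v u u + (-(4 * v) * sigmaForm u u) • u := by
  have hv0 := (pos_of_mem hv).ne'
  have hs := sq_sqrt_of_mem hv
  rw [linMap_apply, quadMap_apply, sigmaForm_apply]
  set s := √(4 * v ^ 2 - 1) with hs'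
  ext i
  fin_cases i <;>
    simp [field, sigmaSq, curvPlus, curvMinus, pVI, ← hs'] <;> field_simp
  · linear_combination (64 : ℝ) * hs
  · ring
  · ring
  · ring
  · ring

theorem pVI_mem_constraintSet (hv : v ∈ Ioo (1 / 2 : ℝ) 1) : pVI v ∈ constraintSet := by
  have hv0 := (pos_of_mem hv).ne'
  have hs := sq_sqrt_of_mem hv
  simp only [constraintSet, sigmaSq, pVI, mem_ofPred_eq]
  set s := √(4 * v ^ 2 - 1) with hs'
  simp
  field_simp
  linear_combination (-16 : ℝ) * hs

theorem field_pVI (hv : v ∈ Ioo (1 / 2 : ℝ) 1) : field v (pVI v) = 0 := by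
  simpa using field_pVI_add hv 0

theorem contDiff_field (v : ℝ) : ContDiff ℝ ∞ (field v) := by
  rw [contDiff_pi]
  intro i
  fin_cases i <;> simp [field, sigmaSq, curvPlus, curvMinus] <;> fun_prop

theorem hasFDerivAt_field (hv : v ∈ Ioo (1 / 2 : ℝ) 1) :
    HasFDerivAt (field v) (linMap v) (pVI v) := by
  have h0 : HasFDerivAt (fun u : Phase => linMap v u + quadMap v u u +
      (-(4 * v) * sigmaForm u u) • u) (linMap v) 0 := by
    have hq := (quadMap v).isBoundedBilinearMap.hasFDerivAt (0 : Phase × Phase)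
    have hσ := sigmaForm.isBoundedBilinearMap.hasFDerivAt (0 : Phase × Phase)
    have hd : HasFDerivAt (fun u : Phase => (u, u))
      ((ContinuousLinearMap.id ℝ Phase).prod (ContinuousLinearMap.id ℝ Phase)) 0 :=
      (hasFDerivAt_id _).prodMk (hasFDerivAt_id _)
    have h1 := HasFDerivAt.comp (f := fun u : Phase => (u, u)) (0 : Phase)
      (g := fun p : Phase × Phase => quadMap v p.1 p.2) hq hd
    have h2 := HasFDerivAt.comp (f := fun u : Phase => (u, u)) (0 : Phase)
      (g := fun p : Phase × Phase => sigmaForm p.1 p.2) hσ hd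
    have h3 := (((linMap v).hasFDerivAt (x := 0)).add h1).add
      ((h2.const_mul (-(4 * v))).smul (hasFDerivAt_id (0 : Phase)))
    refine h3.congr_fderiv ?_
    ext u
    simp
  have h1 : HasFDerivAt (fun x : Phase => x - pVI v) (ContinuousLinearMap.id ℝ Phase) (pVI v) :=
    (hasFDerivAt_id _).sub_const _
  rw [← sub_self (pVI v)] at h0
  refine (HasFDerivAt.comp (f := fun x : Phase => x - pVI v) (pVI v) h0 h1).congr_of_eventuallyEq
    (Eventually.of_forall fun x => ?_)
  rw [Function.comp_apply, ← field_pVI_add hv, add_sub_cancel]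

theorem hasStrictFDerivAt_field (hv : v ∈ Ioo (1 / 2 : ℝ) 1) :
    HasStrictFDerivAt (field v) (linMap v) (pVI v) :=
  (contDiff_field v).contDiffAt.hasStrictFDerivAt' (hasFDerivAt_field hv) (by simp)

theorem linMap_eSS (hv : v ∈ Ioo (1 / 2 : ℝ) 1) : linMap v (eSS v) = lamSS v • eSS v := by
  have hv0 := (pos_of_mem hv).ne'
  have hs := sq_sqrt_of_mem hv
  have hs0 := (sqrt_pos_of_mem hv).ne'
  have h3 : √3 ^ 2 = (3 : ℝ) := Real.sq_sqrt (by norm_num)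
  have h30 : √3 ≠ (0 : ℝ) := by positivity
  rw [linMap_apply, eSS, lamSS, sqrt_three_mul]
  set s := √(4 * v ^ 2 - 1) with hs'
  set q := √(3 : ℝ)
  ext i
  fin_cases i <;> simp <;> field_simp
  · linear_combination 2 * s ^ 2 * h3 + 6 * hs
  · norm_num
  · norm_num

theorem hasEigenvector_eSS (hv : v ∈ Ioo (1 / 2 : ℝ) 1) :
    Module.End.HasEigenvector (fderiv ℝ (field v) (pVI v) : Phase →ₗ[ℝ] Phase)
      (lamSS v) (eSS v) := by
  rw [(hasFDerivAt_field hv).fderiv]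
  refine ⟨Module.End.mem_eigenspace_iff.2 (linMap_eSS hv), fun h => ?_⟩
  simpa [eSS] using congrFun h 1

/-- The spectrum of the linearization meets `(-∞, -3/v)` nowhere: the other eigenvalues are `-2/v`,
`(4 v² - 1) / v`, and a complex pair with positive real part. -/
theorem isUnit_smul_one_sub_linMap (hv : v ∈ Ioo (1 / 2 : ℝ) 1) {μ : ℝ} (hμ : μ < -(3 / v)) :
    IsUnit (μ • (1 : Phase →L[ℝ] Phase) - linMap v) := by
  have hv0 := (pos_of_mem hv)
  have hs := sq_sqrt_of_mem hv
  have hs0 := (sqrt_pos_of_mem hv)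
  have h3 : √3 ^ 2 = (3 : ℝ) := Real.sq_sqrt (by norm_num)
  have hinj : Function.Injective (μ • (1 : Phase →L[ℝ] Phase) - linMap v : Phase →L[ℝ] Phase) := by
    rw [injective_iff_map_eq_zero]
    intro u hu
    have h : ∀ i, μ * u i - linMap v u i = 0 := fun i => by simpa using congrFun hu i
    have e0 := h 0
    have e1 := h 1
    have e2 := h 2
    have e3 := h 3
    have e4 := h 4
    simp only [linMap_apply] at e0 e1 e2 e3 e4
    simp at e0 e1 e2 e3 e4
    set s := √(4 * v ^ 2 - 1) with hs'
    set q := √(3 : ℝ)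
    have hμ0 : μ < 0 := hμ.trans (by have : 0 < 3 / v := by positivity
                                     linarith)
    have u2 : u 2 = 0 := by
      have : (μ + 3 / v) * u 2 = 0 := by linear_combination e2
      exact (mul_eq_zero.1 this).resolve_left (by linarith)
    have hu0 : ((μ + 2 / v) * (μ - s ^ 2 / v)) * u 0 = 0 := by
      field_simp at e0 e3 e4 ⊢
      linear_combination μ * v / 4 * e0 + s / 2 * (e3 - e4) - μ * v * u 0 * hs
    have hu1 : (μ ^ 2 - s ^ 2 / v * μ + 3 * s ^ 2 / v ^ 2) * u 1 = 0 := by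
      field_simp at e1 e3 e4 ⊢
      linear_combination μ * v * e1 + s * q / 4 * (e3 + e4) - s ^ 2 * u 1 * h3
        - μ * v * u 1 * hs - s * q * μ * v * u2
    have hsv : 0 < s ^ 2 / v := by positivity
    have hv' : 3 / v - 2 / v = 1 / v := by ring
    have hv'' : 0 < 1 / v := by positivity
    have u0 : u 0 = 0 := (mul_eq_zero.1 hu0).resolve_left
      (mul_pos_of_neg_of_neg (by linarith) (by linarith)).ne'
    have u1 : u 1 = 0 := (mul_eq_zero.1 hu1).resolve_left
      (by have := mul_neg_of_pos_of_neg hsv hμ0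
          have : 0 < 3 * s ^ 2 / v ^ 2 := by positivity
          nlinarith [sq_nonneg μ])
    rw [u0, u1] at e3 e4
    ext i
    fin_cases i
    · exact u0
    · exact u1
    · exact u2
    · simpa [hμ0.ne] using e3
    · simpa [hμ0.ne] using e4
  exact ContinuousLinearMap.isUnit_iff_bijective.2
    ⟨hinj, (LinearMap.injective_iff_surjective
      (f := ((μ • (1 : Phase →L[ℝ] Phase) - linMap v : Phase →L[ℝ] Phase) :
        Phase →ₗ[ℝ] Phase))).1 hinj⟩

end Bianchi

namespace Bianchi

/-! ### The constraint and the monotone quantity `N₁ N₂ N₃` -/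

/-- The defect of the constraint, so that `constraintSet` is its zero set. -/
def defect (x : Phase) : ℝ :=
  1 - (sigmaSq x + x 2 ^ 2 + x 3 ^ 2 + x 4 ^ 2 - 2 * x 2 * x 3 - 2 * x 3 * x 4 - 2 * x 4 * x 2)

/-- The product `N₁ N₂ N₃`. -/
def prodN (x : Phase) : ℝ := x 2 * x 3 * x 4

theorem mem_constraintSet_iff {x : Phase} : x ∈ constraintSet ↔ defect x = 0 := by
  simp only [constraintSet, defect, mem_ofPred_eq]
  exact sub_eq_zero.symm

theorem contDiff_defect : ContDiff ℝ ∞ defect := by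
  unfold defect sigmaSq
  fun_prop

theorem contDiff_prodN : ContDiff ℝ ∞ prodN := by
  unfold prodN
  fun_prop

theorem fderiv_defect_apply (x u : Phase) : fderiv ℝ defect x u =
    -(2 * (x 0 * u 0 + x 1 * u 1 + x 2 * u 2 + x 3 * u 3 + x 4 * u 4 - (x 2 * u 3 + u 2 * x 3)
      - (x 3 * u 4 + u 3 * x 4) - (x 4 * u 2 + u 4 * x 2))) := by
  have hp : ∀ i : Fin 5, HasFDerivAt (fun x : Phase => x i)
    (ContinuousLinearMap.proj i : Phase →L[ℝ] ℝ) x := fun i => hasFDerivAt_apply i x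
  have h := (((((((((hp 0).pow 2).add ((hp 1).pow 2)).add ((hp 2).pow 2)).add ((hp 3).pow 2)).add
    ((hp 4).pow 2)).sub (((hp 2).const_mul 2).mul (hp 3))).sub
    (((hp 3).const_mul 2).mul (hp 4))).sub (((hp 4).const_mul 2).mul (hp 2))).const_sub 1
  have h' : HasFDerivAt defect _ x := h
  rw [h'.fderiv]
  simp
  ring

theorem fderiv_prodN_apply (x u : Phase) : fderiv ℝ prodN x u =
    u 2 * x 3 * x 4 + x 2 * u 3 * x 4 + x 2 * x 3 * u 4 := by
  have hp : ∀ i : Fin 5, HasFDerivAt (fun x : Phase => x i)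
    (ContinuousLinearMap.proj i : Phase →L[ℝ] ℝ) x := fun i => hasFDerivAt_apply i x
  have h' : HasFDerivAt prodN _ x := ((hp 2).mul (hp 3)).mul (hp 4)
  rw [h'.fderiv]
  simp
  ring

/-- The constraint is propagated by the flow. -/
theorem fderiv_defect_field (v : ℝ) (x : Phase) :
    fderiv ℝ defect x (field v x) = -(8 * v * sigmaSq x) * defect x := by
  rw [fderiv_defect_apply]
  have h3 : √3 * √3 = (3 : ℝ) := Real.mul_self_sqrt (by norm_num)
  simp [field, defect, sigmaSq, curvPlus, curvMinus]
  ring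

theorem fderiv_prodN_field (v : ℝ) (x : Phase) :
    fderiv ℝ prodN x (field v x) = -(12 * v * sigmaSq x) * prodN x := by
  rw [fderiv_prodN_apply]
  simp [field, prodN, sigmaSq]
  ring

theorem hasDerivWithinAt_comp_of_contDiff {f : Phase → ℝ} (hf : ContDiff ℝ ∞ f) {x : ℝ → Phase}
    {x' : Phase} {S : Set ℝ} {t : ℝ} (hx : HasDerivWithinAt x x' S t) :
    HasDerivWithinAt (fun t => f (x t)) (fderiv ℝ f (x t) x') S t :=
  ((hf.differentiable (by simp)) (x t)).hasFDerivAt.comp_hasDerivWithinAt t hx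

theorem hasDerivAt_comp_of_contDiff {f : Phase → ℝ} (hf : ContDiff ℝ ∞ f) {x : ℝ → Phase}
    {x' : Phase} {t : ℝ} (hx : HasDerivAt x x' t) :
    HasDerivAt (fun t => f (x t)) (fderiv ℝ f (x t) x') t :=
  ((hf.differentiable (by simp)) (x t)).hasFDerivAt.comp_hasDerivAt t hx

/-! ### The invariant curve through the equilibrium -/

/-- A solution of `s γ' = m γ` with exponent `m ≤ 5/6` that vanishes at `0` and is differentiable
there vanishes identically: otherwise it would decay no faster than `s ^ (5/6)`. -/
theorem eq_zero_of_mul_deriv_eq {γ γ' m : ℝ → ℝ} {r a : ℝ} (h0 : γ 0 = 0) (ha : HasDerivAt γ a 0)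
    (hγ : ∀ s ∈ Ioo 0 r, HasDerivAt γ (γ' s) s) (hm : ∀ s ∈ Ioo 0 r, s * γ' s = m s * γ s)
    (hm' : ∀ s ∈ Ioo 0 r, m s ≤ 5 / 6) {s : ℝ} (hs : s ∈ Ioo 0 r) : γ s = 0 := by
  have hd : ∀ s ∈ Ioo 0 r, HasDerivAt (fun s => γ s ^ 6 / s ^ 5)
      ((6 * m s - 5) * (γ s ^ 6 / s ^ 6)) s := by
    intro s hs
    have hs0 : s ≠ 0 := hs.1.ne'
    have h := ((hγ s hs).pow 6).div (hasDerivAt_pow 5 s) (pow_ne_zero 5 hs0)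
    refine h.congr_deriv ?_
    simp only [Pi.pow_apply]
    push_cast
    field_simp
    linear_combination 6 * γ s ^ 5 * hm s hs
  have hanti : AntitoneOn (fun s => γ s ^ 6 / s ^ 5) (Ioo 0 r) := by
    refine antitoneOn_of_hasDerivWithinAt_nonpos (convex_Ioo 0 r)
      (fun s hs => (hd s hs).continuousAt.continuousWithinAt)
      (fun s hs => (hd s (interior_subset hs)).hasDerivWithinAt) (fun s hs => ?_)
    have hs' : s ∈ Ioo 0 r := interior_subset hs
    have h1 := hm' s hs'
    have h2 : 0 < s := hs'.1
    exact mul_nonpos_of_nonpos_of_nonneg (by linarith) (by positivity)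
  have hlim : Tendsto (fun s => γ s ^ 6 / s ^ 5) (𝓝[>] 0) (𝓝 0) := by
    have h1 : Tendsto (fun s => s⁻¹ * γ s) (𝓝[>] 0) (𝓝 a) := by
      have := (hasDerivAt_iff_tendsto_slope_zero.1 ha).mono_left
        (nhdsWithin_mono 0 (show Ioi (0 : ℝ) ⊆ {0}ᶜ from fun x hx => (mem_Ioi.1 hx).ne'))
      simpa [h0] using this
    have h2 : Tendsto γ (𝓝[>] 0) (𝓝 0) := by
      simpa [h0] using ha.continuousAt.tendsto.mono_left nhdsWithin_le_nhds
    have h3 := (h1.pow 5).mul h2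
    rw [mul_zero] at h3
    refine h3.congr fun s => ?_
    rw [mul_pow, inv_pow]
    ring
  have hle : γ s ^ 6 / s ^ 5 ≤ 0 := by
    refine ge_of_tendsto hlim ?_
    filter_upwards [Ioo_mem_nhdsGT hs.1] with t ht
    exact hanti ⟨ht.1, ht.2.trans hs.2⟩ hs ht.2.le
  have hs5 : 0 < s ^ 5 := pow_pos hs.1 5
  have : γ s ^ 6 ≤ 0 := by
    by_contra hc
    exact absurd (div_pos (not_le.1 hc) hs5) (not_lt.2 hle)
  exact pow_eq_zero_iff (by norm_num : 6 ≠ 0) |>.1 (le_antisymm this (by positivity))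

variable {v : ℝ}

theorem lamSS_neg (hv : v ∈ Ioo (1 / 2 : ℝ) 1) : lamSS v < 0 := by
  have := pos_of_mem hv
  rw [lamSS, neg_lt_zero]
  positivity

theorem sigmaSq_pVI (hv : v ∈ Ioo (1 / 2 : ℝ) 1) : sigmaSq (pVI v) = 1 / (4 * v ^ 2) := by
  have := (pos_of_mem hv).ne'
  simp [sigmaSq, pVI]
  field_simp
  norm_num

/-- The smooth invariant curve of the constrained system tangent to the strong-stable eigenvector,
in the parameter that linearizes the flow on it. -/
theorem exists_linearizing_curve (hv : v ∈ Ioo (1 / 2 : ℝ) 1) :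
    ∃ (r : ℝ) (h : ℝ → Phase), 0 < r ∧ ContDiffOn ℝ ∞ h (Ioo (-r) r) ∧ h 0 = pVI v ∧
      HasDerivAt h (eSS v) 0 ∧
      (∀ s ∈ Ioo (-r) r, ∃ h' : Phase, HasDerivAt h h' s ∧ (lamSS v * s) • h' = field v (h s)) ∧
      ∀ s ∈ Ioo (-r) r, h s ∈ constraintSet := by
  have hv0 := pos_of_mem hv
  have hl := lamSS_neg hv
  obtain ⟨r, h, hr, hsm, h0, he, hode⟩ := exists_invariantCurve (linMap v) (quadMap v) sigmaForm
    ((-(4 * v)) • ContinuousLinearMap.lsmul ℝ ℝ) hl.ne (linMap_eSS hv) (fun k =>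
      isUnit_smul_one_sub_linMap hv (by
        have : lamSS v = -(3 / v) := rfl
        have hk : (0 : ℝ) ≤ k := k.cast_nonneg
        nlinarith))
  have hode' : ∀ s ∈ Ioo (-r) r, ∃ h' : Phase, HasDerivAt (fun s => pVI v + h s) h' s ∧
      (lamSS v * s) • h' = field v (pVI v + h s) := by
    intro s hs
    obtain ⟨h', h1, h2⟩ := hode s hs
    refine ⟨h', h1.const_add _, ?_⟩
    rw [h2, field_pVI_add hv]
    simp [mul_smul]
  -- the defect of the constraint has the exponent `2/3` along the curve
  have hc : ContinuousAt (fun s => sigmaSq (pVI v + h s)) 0 := by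
    have : Continuous sigmaSq := by unfold sigmaSq; fun_prop
    exact this.continuousAt.comp (continuousAt_const.add he.continuousAt)
  have hlt : sigmaSq (pVI v + h 0) < 5 / (16 * v ^ 2) := by
    rw [h0, add_zero, sigmaSq_pVI hv, div_lt_div_iff₀ (by positivity) (by positivity)]
    nlinarith [sq_pos_of_pos hv0]
  obtain ⟨ρ, hρ, hρ'⟩ := Metric.eventually_nhds_iff.1 (hc.eventually_lt_const hlt)
  have hmin : 0 < min r ρ := lt_min hr hρ
  have hsub : Ioo (-(min r ρ)) (min r ρ) ⊆ Ioo (-r) r :=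
    Ioo_subset_Ioo (neg_le_neg (min_le_left _ _)) (min_le_left _ _)
  refine ⟨min r ρ, fun s => pVI v + h s, hmin, (contDiffOn_const.add hsm).mono hsub, by simp [h0],
    he.const_add _, fun s hs => hode' s (hsub hs), ?_⟩
  choose! h' hh' hode'' using hode'
  set γ : ℝ → ℝ := fun s => defect (pVI v + h s) with hγ
  have hγ0 : γ 0 = 0 := by
    rw [hγ]
    simpa [h0] using mem_constraintSet_iff.1 (pVI_mem_constraintSet hv)
  have hγd : ∀ s ∈ Ioo (-r) r, HasDerivAt γ (fderiv ℝ defect (pVI v + h s) (h' s)) s :=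
    fun s hs => hasDerivAt_comp_of_contDiff contDiff_defect (hh' s hs)
  have hγm : ∀ s ∈ Ioo (-r) r, s * fderiv ℝ defect (pVI v + h s) (h' s) =
      8 * v ^ 2 / 3 * sigmaSq (pVI v + h s) * γ s := by
    intro s hs
    have h1 := congrArg (fderiv ℝ defect (pVI v + h s)) (hode'' s hs)
    rw [map_smul, fderiv_defect_field, lamSS, smul_eq_mul] at h1
    rw [hγ]
    field_simp at h1 ⊢
    linarith
  have hm : ∀ s, |s| < min r ρ → 8 * v ^ 2 / 3 * sigmaSq (pVI v + h s) ≤ 5 / 6 := by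
    intro s hs
    have h1 := (@hρ' s (by simpa using hs.trans_le (min_le_right _ _))).le
    calc 8 * v ^ 2 / 3 * sigmaSq (pVI v + h s) ≤ 8 * v ^ 2 / 3 * (5 / (16 * v ^ 2)) := by gcongr
      _ = 5 / 6 := by field_simp; norm_num
  have hneg : ∀ s, s ∈ Ioo (-r) r → -s ∈ Ioo (-r) r := fun s hs =>
    ⟨by linarith [hs.2], by linarith [hs.1]⟩
  intro s hs
  rw [mem_constraintSet_iff]
  rcases lt_trichotomy s 0 with hneg0 | rfl | hpos
  · have hr0 : (0 : ℝ) ∈ Ioo (-r) r := ⟨by linarith, hr⟩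
    have hcomp : ∀ t ∈ Ioo (-r) r, HasDerivAt (fun t => γ (-t))
        (-(fderiv ℝ defect (pVI v + h (-t)) (h' (-t)))) t := fun t ht => by
      simpa [Function.comp_def] using (hγd (-t) (hneg t ht)).scomp t (hasDerivAt_neg t)
    have := eq_zero_of_mul_deriv_eq (γ := fun t => γ (-t)) (r := min r ρ)
      (γ' := fun t => -(fderiv ℝ defect (pVI v + h (-t)) (h' (-t))))
      (m := fun t => 8 * v ^ 2 / 3 * sigmaSq (pVI v + h (-t))) (s := -s)
      (by simpa using hγ0) (hcomp 0 hr0)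
      (fun t ht => hcomp t (hsub ⟨by linarith [ht.1], ht.2⟩))
      (fun t ht => by
        have := hγm (-t) (hneg t (hsub ⟨by linarith [ht.1], ht.2⟩))
        linarith)
      (fun t ht => hm (-t) (by rw [abs_neg, abs_of_pos ht.1]; exact ht.2))
      ⟨by linarith, by linarith [hs.1]⟩
    simpa using this
  · exact hγ0
  · exact eq_zero_of_mul_deriv_eq hγ0 (hγd 0 ⟨by linarith, hr⟩)
      (fun t ht => hγd t (hsub ⟨by linarith [ht.1], ht.2⟩))
      (fun t ht => hγm t (hsub ⟨by linarith [ht.1], ht.2⟩))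
      (fun t ht => hm t (by rw [abs_of_pos ht.1]; exact ht.2)) ⟨hpos, hs.2⟩

end Bianchi

namespace Bianchi

variable {v : ℝ}

theorem fderiv_prodN_eSS_neg (hv : v ∈ Ioo (1 / 2 : ℝ) 1) :
    fderiv ℝ prodN (pVI v) (eSS v) < 0 := by
  have hv0 := pos_of_mem hv
  have hs := sq_sqrt_of_mem hv
  have hs0 := sqrt_pos_of_mem hv
  rw [fderiv_prodN_apply, eSS, pVI, sqrt_three_mul]
  set s := √(4 * v ^ 2 - 1)
  simp
  positivity

/-- The invariant curve through the equilibrium, reparametrized as a graph over `Σ₋`. The last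
property links it to the linearizing parameter. -/
theorem exists_graph_curve (hv : v ∈ Ioo (1 / 2 : ℝ) 1) {r : ℝ} {h : ℝ → Phase} (hr : 0 < r)
    (hsm : ContDiffOn ℝ ∞ h (Ioo (-r) r)) (h0 : h 0 = pVI v) (he : HasDerivAt h (eSS v) 0)
    (hode : ∀ s ∈ Ioo (-r) r, ∃ h' : Phase, HasDerivAt h h' s ∧
      (lamSS v * s) • h' = field v (h s)) :
    ∃ (δ : ℝ) (c : ℝ → Phase), 0 < δ ∧ ContDiffOn ℝ ∞ c (Ioo (-δ) δ) ∧ c 0 = pVI v ∧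
      HasDerivAt c (eSS v) 0 ∧ (∀ s ∈ Ioo (-δ) δ, c s 1 = s) ∧
      (∀ s ∈ Ioo (-δ) δ, field v (c s) 1 • deriv c s = field v (c s)) ∧
      StrictAntiOn (fun s => prodN (c s)) (Ioo (-δ) δ) ∧
      ∀ s ∈ Ioo (-δ) δ, ∃ σ ∈ Ioo (-r) r, c s = h σ := by
  have hr0 : (0 : ℝ) ∈ Ioo (-r) r := ⟨by linarith, hr⟩
  have hh : ContDiffAt ℝ ∞ h 0 := hsm.contDiffAt (isOpen_Ioo.mem_nhds hr0)
  -- `φ` is the `Σ₋`-coordinate along the curve and `ψ` its local inverse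
  set φ : ℝ → ℝ := fun s => h s 1 with hφ
  have hφs : ContDiffAt ℝ ∞ φ 0 := contDiffAt_pi.1 hh 1
  have hφd : HasDerivAt φ 1 0 := by simpa [eSS] using hasDerivAt_pi.1 he 1
  have hφ0 : φ 0 = 0 := by simp [hφ, h0, pVI]
  have hφe : HasFDerivAt φ ((ContinuousLinearEquiv.refl ℝ ℝ : ℝ ≃L[ℝ] ℝ) : ℝ →L[ℝ] ℝ) 0 := by
    refine hφd.hasFDerivAt.congr_fderiv ?_
    ext
    simp
  have hne : (∞ : WithTop ℕ∞) ≠ 0 := by simp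
  set e := hφs.toOpenPartialHomeomorph φ hφe hne with he_def
  have hecoe : (e : ℝ → ℝ) = φ := hφs.toOpenPartialHomeomorph_coe hφe hne
  have hsrc : (0 : ℝ) ∈ e.source := hφs.mem_toOpenPartialHomeomorph_source hφe hne
  have htgt : (0 : ℝ) ∈ e.target := by
    have := e.map_source hsrc
    rwa [hecoe, hφ0] at this
  have hψ0 : e.symm 0 = 0 := by
    have := e.left_inv hsrc
    rwa [hecoe, hφ0] at this
  have hψs : ContDiffAt ℝ ∞ e.symm 0 := by
    have := hφs.to_localInverse hφe hne
    rw [hφ0] at this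
    exact this
  have hψd : HasDerivAt e.symm 1 0 := by
    have h1 : HasDerivAt (φ ∘ e.symm) 1 0 := by
      refine (hasDerivAt_id (0 : ℝ)).congr_of_eventuallyEq ?_
      filter_upwards [e.open_target.mem_nhds htgt] with s hs
      rw [Function.comp_apply, ← hecoe]
      exact e.right_inv hs
    have h2 := (hψs.differentiableAt hne).hasDerivAt
    have h3 : HasDerivAt (φ ∘ e.symm) (1 * deriv e.symm 0) 0 :=
      HasDerivAt.comp (0 : ℝ) (by rw [hψ0]; exact hφd) h2
    have := h1.unique h3
    rw [one_mul] at this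
    rwa [← this] at h2
  set c : ℝ → Phase := fun s => h (e.symm s) with hc
  have hcs : ContDiffAt ℝ ∞ c 0 := ContDiffAt.comp (0 : ℝ) (by rw [hψ0]; exact hh) hψs
  have hcd : HasDerivAt c (eSS v) 0 := by
    have := HasDerivAt.scomp (g₁ := h) (h := e.symm) (0 : ℝ) (by rw [hψ0]; exact he) hψd
    simpa [Function.comp_def] using this
  have hc0 : c 0 = pVI v := by rw [hc]; beta_reduce; rw [hψ0, h0]
  -- the derivative of `N₁ N₂ N₃` along the curve stays negative near the equilibrium
  have hD : ContDiffAt ℝ ∞ (fun s => prodN (c s)) 0 := contDiff_prodN.contDiffAt.comp (0 : ℝ) hcs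
  have hD' : deriv (fun s => prodN (c s)) 0 < 0 := by
    rw [(hasDerivAt_comp_of_contDiff contDiff_prodN hcd).deriv, hc0]
    exact fderiv_prodN_eSS_neg hv
  have hDc : ContinuousAt (deriv fun s => prodN (c s)) 0 :=
    (hD.derivWithin (m := 0) (by simp)).continuousAt
  have hev : ∀ᶠ s in 𝓝 (0 : ℝ), s ∈ e.target ∧ e.symm s ∈ Ioo (-r) r ∧
      ContDiffAt ℝ ∞ e.symm s ∧ deriv (fun s => prodN (c s)) s < 0 := by
    have hmem : ∀ᶠ s in 𝓝 (0 : ℝ), e.symm s ∈ Ioo (-r) r :=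
      hψs.continuousAt.eventually_mem (by rw [hψ0]; exact isOpen_Ioo.mem_nhds hr0)
    have hφc : ContinuousAt (deriv φ) 0 := (hφs.derivWithin (m := 0) (by simp)).continuousAt
    have hφne : ∀ᶠ s in 𝓝 (0 : ℝ), deriv φ (e.symm s) ≠ 0 := by
      refine (ContinuousAt.comp (g := deriv φ) (by rwa [hψ0]) hψs.continuousAt).eventually_ne ?_
      rw [Function.comp_apply, hψ0, hφd.deriv]
      exact one_ne_zero
    filter_upwards [e.open_target.mem_nhds htgt, hmem, hφne, hDc.eventually_lt_const hD']
      with s h1 h2 h3 h4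
    refine ⟨h1, h2, ?_, h4⟩
    have hφa : ContDiffAt ℝ ∞ φ (e.symm s) :=
      contDiffAt_pi.1 (hsm.contDiffAt (isOpen_Ioo.mem_nhds h2)) 1
    refine e.contDiffAt_symm_deriv h3 h1 ?_ ?_
    · rw [hecoe]
      exact (hφa.differentiableAt hne).hasDerivAt
    · rwa [hecoe]
  obtain ⟨δ, hδ, hδ'⟩ := Metric.eventually_nhds_iff.1 hev
  have hP : ∀ s ∈ Ioo (-δ) δ, s ∈ e.target ∧ e.symm s ∈ Ioo (-r) r ∧
      ContDiffAt ℝ ∞ e.symm s ∧ deriv (fun s => prodN (c s)) s < 0 := fun s hs =>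
    hδ' (by rw [Real.dist_eq, sub_zero]; exact abs_lt.2 hs)
  have hcsm : ∀ s ∈ Ioo (-δ) δ, ContDiffAt ℝ ∞ c s := fun s hs =>
    ContDiffAt.comp s (hsm.contDiffAt (isOpen_Ioo.mem_nhds (hP s hs).2.1)) (hP s hs).2.2.1
  have hc1 : ∀ s ∈ Ioo (-δ) δ, c s 1 = s := by
    intro s hs
    have := e.right_inv (hP s hs).1
    rwa [hecoe] at this
  refine ⟨δ, c, hδ, fun s hs => (hcsm s hs).contDiffWithinAt, hc0, hcd, hc1, fun s hs => ?_, ?_,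
    fun s hs => ⟨_, (hP s hs).2.1, rfl⟩⟩
  · obtain ⟨h', hh', hF⟩ := hode _ (hP s hs).2.1
    have hψ' := ((hP s hs).2.2.1.differentiableAt hne).hasDerivAt
    have hc' : HasDerivAt c (deriv e.symm s • h') s := HasDerivAt.scomp (g₁ := h) s hh' hψ'
    have h1 : deriv e.symm s * h' 1 = 1 := by
      have h2 : HasDerivAt (fun s => c s 1) (deriv e.symm s * h' 1) s := hasDerivAt_pi.1 hc' 1
      refine h2.unique ((hasDerivAt_id s).congr_of_eventuallyEq ?_)
      filter_upwards [isOpen_Ioo.mem_nhds hs] with t ht using hc1 t ht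
    rw [hc'.deriv, hc]
    beta_reduce
    rw [← hF, Pi.smul_apply, smul_smul, smul_eq_mul]
    congr 1
    linear_combination lamSS v * e.symm s * h1
  · refine strictAntiOn_of_deriv_neg (convex_Ioo _ _) (fun s hs =>
      (contDiff_prodN.continuous.continuousAt.comp (hcsm s hs).continuousAt).continuousWithinAt)
      fun s hs => (hP s (interior_subset hs)).2.2.2

/-- Along the linearizing parameter the flow is explicit. -/
theorem isForwardSolution_comp_exp (hv : v ∈ Ioo (1 / 2 : ℝ) 1) {r : ℝ} {h : ℝ → Phase}
    (hode : ∀ s ∈ Ioo (-r) r, ∃ h' : Phase, HasDerivAt h h' s ∧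
      (lamSS v * s) • h' = field v (h s))
    (hM : ∀ s ∈ Ioo (-r) r, h s ∈ constraintSet) {σ : ℝ} (hσ : σ ∈ Ioo (-r) r) :
    IsForwardSolution (field v) constraintSet (fun t => h (σ * Real.exp (lamSS v * t))) := by
  intro t ht
  have hl := lamSS_neg hv
  have hexp : Real.exp (lamSS v * t) ≤ 1 :=
    Real.exp_le_one_iff.2 (mul_nonpos_of_nonpos_of_nonneg hl.le ht)
  have hmem : σ * Real.exp (lamSS v * t) ∈ Ioo (-r) r := by
    rw [mem_Ioo, ← abs_lt] at hσ ⊢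
    rw [abs_mul, Real.abs_exp]
    exact (mul_le_of_le_one_right (abs_nonneg _) hexp).trans_lt hσ
  obtain ⟨h', h1, h2⟩ := hode _ hmem
  have h3 : HasDerivAt (fun t => σ * Real.exp (lamSS v * t))
      (lamSS v * (σ * Real.exp (lamSS v * t))) t := by
    refine ((((hasDerivAt_id t).const_mul (lamSS v)).exp).const_mul σ).congr_deriv ?_
    simp only [id, mul_one]
    ring
  refine ⟨?_, hM _ hmem⟩
  have h4 := (HasDerivAt.scomp (g₁ := h) t h1 h3).hasDerivWithinAt (s := Ici 0)
  rwa [h2] at h4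

theorem isBigO_comp_exp (hv : v ∈ Ioo (1 / 2 : ℝ) 1) {h : ℝ → Phase} (h0 : h 0 = pVI v)
    (he : HasDerivAt h (eSS v) 0) (σ : ℝ) :
    (fun t => h (σ * Real.exp (lamSS v * t)) - pVI v) =O[atTop]
      fun t => Real.exp (lamSS v * t) := by
  have hlim : Tendsto (fun t => σ * Real.exp (lamSS v * t)) atTop (𝓝 0) := by
    have : Tendsto (fun t => lamSS v * t) atTop atBot :=
      tendsto_id.const_mul_atTop_of_neg (lamSS_neg hv)
    simpa using (Real.tendsto_exp_atBot.comp this).const_mul σ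
  have h1 := he.isBigO_sub.comp_tendsto hlim
  simp only [Function.comp_def, h0, sub_zero] at h1
  exact h1.trans ((isBigO_refl _ _).const_mul_left σ)

end Bianchi

namespace Bianchi

/-! ### Instability transverse to the invariant curve -/

/-- The growth inequality for the quadratic form `ξ₁² + k ξ₁ ξ₂ + ξ₂² + ξ₃²` under the linear
system `ξ₁' = a ξ₁ + b ξ₂`, `ξ₂' = -b ξ₁`, `ξ₃' = a ξ₃`, perturbed by small terms `ρᵢ`. For
`k b = a` the form grows at the rate `a` under the unperturbed system. -/
theorem quadForm_deriv_nonneg {ξ₁ ξ₂ ξ₃ ρ₁ ρ₂ ρ₃ a b k L M N c : ℝ} (hkb : k * b = a) (hk0 : 0 ≤ k)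
    (hk1 : k ≤ 1) (ha : 0 ≤ a) (h₁ : |ξ₁| ≤ L * N) (h₂ : |ξ₂| ≤ L * N) (h₃ : |ξ₃| ≤ L * N)
    (r₁ : |ρ₁| ≤ M * N) (r₂ : |ρ₂| ≤ M * N) (r₃ : |ρ₃| ≤ M * N)
    (hc : c * N ^ 2 ≤ ξ₁ ^ 2 + k * (ξ₁ * ξ₂) + ξ₂ ^ 2 + ξ₃ ^ 2) (hLM : 8 * (L * M) ≤ a * c) :
    0 ≤ 2 * ξ₁ * (a * ξ₁ + b * ξ₂ + ρ₁) + k * ((a * ξ₁ + b * ξ₂ + ρ₁) * ξ₂ + ξ₁ * (-b * ξ₁ + ρ₂))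
      + 2 * ξ₂ * (-b * ξ₁ + ρ₂) + 2 * ξ₃ * (a * ξ₃ + ρ₃) := by
  have key : ∀ {x y : ℝ}, |x| ≤ L * N → |y| ≤ M * N → -(L * M * N ^ 2) ≤ x * y := by
    intro x y hx hy
    have h : |x * y| ≤ L * M * N ^ 2 := by
      rw [abs_mul]
      calc |x| * |y| ≤ (L * N) * (M * N) :=
          mul_le_mul hx hy (abs_nonneg _) ((abs_nonneg _).trans hx)
        _ = _ := by ring
    exact (abs_le.1 h).1
  have h0 : 0 ≤ L * M * N ^ 2 := by
    have := mul_nonneg ((abs_nonneg _).trans h₁) ((abs_nonneg _).trans r₁)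
    linarith [show L * N * (M * N) = L * M * N ^ 2 by ring]
  have e1 := key h₁ r₁
  have e2 := key h₂ r₂
  have e3 := key h₃ r₃
  have e4 : -(L * M * N ^ 2) ≤ k * (ξ₂ * ρ₁) := by
    have := mul_le_mul_of_nonneg_left (key h₂ r₁) hk0
    nlinarith
  have e5 : -(L * M * N ^ 2) ≤ k * (ξ₁ * ρ₂) := by
    have := mul_le_mul_of_nonneg_left (key h₁ r₂) hk0
    nlinarith
  have e6 := mul_le_mul_of_nonneg_left hc ha
  have e7 := mul_le_mul_of_nonneg_right hLM (sq_nonneg N)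
  have e8 := mul_nonneg ha (sq_nonneg ξ₃)
  have e9 : 2 * ξ₁ * (a * ξ₁ + b * ξ₂ + ρ₁) + k * ((a * ξ₁ + b * ξ₂ + ρ₁) * ξ₂ +
      ξ₁ * (-b * ξ₁ + ρ₂)) + 2 * ξ₂ * (-b * ξ₁ + ρ₂) + 2 * ξ₃ * (a * ξ₃ + ρ₃)
      = a * (ξ₁ ^ 2 + k * (ξ₁ * ξ₂) + ξ₂ ^ 2 + ξ₃ ^ 2) + a * ξ₃ ^ 2 + 2 * (ξ₁ * ρ₁) +
        2 * (ξ₂ * ρ₂) + 2 * (ξ₃ * ρ₃) + k * (ξ₂ * ρ₁) + k * (ξ₁ * ρ₂) := by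
    linear_combination (ξ₂ ^ 2 - ξ₁ ^ 2) * hkb
  rw [e9]
  linarith

/-- The coordinate functionals on the phase space. -/
noncomputable abbrev coord (i : Fin 5) : Phase →L[ℝ] ℝ := ContinuousLinearMap.proj i

/-- First of three linear functionals that vanish on `eSS v` and span, together, the unstable left
eigenspace of the linearization. -/
noncomputable def xi₁ (v : ℝ) : Phase →L[ℝ] ℝ :=
  coord 1 - (√3 * √(4 * v ^ 2 - 1) / (8 * v ^ 2 + 1)) • coord 2

/-- Second of the unstable left eigenfunctionals; it rotates with `xi₁`. -/
noncomputable def xi₂ (v : ℝ) : Phase →L[ℝ] ℝ :=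
  coord 3 + coord 4 -
    (√(4 * v ^ 2 - 1) ^ 2 / (8 * v ^ 2 + 1)) • coord 2

/-- Third of the unstable left eigenfunctionals, with the eigenvalue `(4 v² - 1) / v`. -/
noncomputable def xi₃ (v : ℝ) : Phase →L[ℝ] ℝ :=
  coord 0 +
    (2 / √(4 * v ^ 2 - 1)) • (coord 3 - coord 4)

theorem xi₁_apply (v : ℝ) (u : Phase) :
    xi₁ v u = u 1 - √3 * √(4 * v ^ 2 - 1) / (8 * v ^ 2 + 1) * u 2 := by
  simp [xi₁]

theorem xi₂_apply (v : ℝ) (u : Phase) :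
    xi₂ v u = u 3 + u 4 - √(4 * v ^ 2 - 1) ^ 2 / (8 * v ^ 2 + 1) * u 2 := by
  simp [xi₂]

theorem xi₃_apply (v : ℝ) (u : Phase) :
    xi₃ v u = u 0 + 2 / √(4 * v ^ 2 - 1) * (u 3 - u 4) := by
  simp [xi₃]

variable {v : ℝ}

theorem xi_eSS (hv : v ∈ Ioo (1 / 2 : ℝ) 1) :
    xi₁ v (eSS v) = 0 ∧ xi₂ v (eSS v) = 0 ∧ xi₃ v (eSS v) = 0 := by
  have hs0 := (sqrt_pos_of_mem hv).ne'
  have h3 : √3 ^ 2 = (3 : ℝ) := Real.sq_sqrt (by norm_num)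
  have h30 : √3 ≠ (0 : ℝ) := by positivity
  have h8 : 8 * v ^ 2 + 1 ≠ 0 := by positivity
  rw [xi₁_apply, xi₂_apply, xi₃_apply, eSS, sqrt_three_mul]
  set s := √(4 * v ^ 2 - 1)
  set q := √(3 : ℝ)
  refine ⟨?_, ?_, ?_⟩ <;> simp <;> field_simp
  · norm_num
  · linear_combination 2 * s * h3

theorem xi_linMap (hv : v ∈ Ioo (1 / 2 : ℝ) 1) (u : Phase) :
    xi₁ v (linMap v u) = √(4 * v ^ 2 - 1) ^ 2 / v * xi₁ v u + √3 * √(4 * v ^ 2 - 1) / v * xi₂ v u ∧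
    xi₂ v (linMap v u) = -(√3 * √(4 * v ^ 2 - 1) / v) * xi₁ v u ∧
    xi₃ v (linMap v u) = √(4 * v ^ 2 - 1) ^ 2 / v * xi₃ v u := by
  have hv0 := (pos_of_mem hv).ne'
  have hs := sq_sqrt_of_mem hv
  have hs0 := (sqrt_pos_of_mem hv).ne'
  have h3 : √3 ^ 2 = (3 : ℝ) := Real.sq_sqrt (by norm_num)
  have h8 : 8 * v ^ 2 + 1 ≠ 0 := by positivity
  simp only [xi₁_apply, xi₂_apply, xi₃_apply, linMap_apply]
  set s := √(4 * v ^ 2 - 1)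
  set q := √(3 : ℝ)
  refine ⟨?_, ?_, ?_⟩ <;> simp <;> field_simp
  · linear_combination (-(8 * v ^ 2 + 1) * u 1 + 2 * q * s * u 2) * hs
  · linear_combination -4 * s * u 2 * h3
  · linear_combination -4 * u 0 * hs

theorem fderiv_defect_pVI (hv : v ∈ Ioo (1 / 2 : ℝ) 1) (u : Phase) :
    fderiv ℝ defect (pVI v) u = (u 0 - √(4 * v ^ 2 - 1) * (u 3 - u 4)) / v := by
  have hv0 := (pos_of_mem hv).ne'
  rw [fderiv_defect_apply, pVI]
  set s := √(4 * v ^ 2 - 1)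
  simp
  field_simp
  ring

/-- The functionals `xi₁`, `xi₂`, `xi₃`, the differential of the constraint and the coordinate `Σ₋`
together control the norm. -/
theorem exists_mul_sq_norm_le (hv : v ∈ Ioo (1 / 2 : ℝ) 1) : ∃ κ : ℝ, 0 < κ ∧ ∀ u : Phase, u 1 = 0 →
    κ * ‖u‖ ^ 2 ≤ xi₁ v u ^ 2 + xi₂ v u ^ 2 + xi₃ v u ^ 2 + fderiv ℝ defect (pVI v) u ^ 2 := by
  have hv0 := (pos_of_mem hv)
  have hs0 := (sqrt_pos_of_mem hv)
  let Λ : Phase →L[ℝ] (Fin 5 → ℝ) := ContinuousLinearMap.pi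
    ![xi₁ v, xi₂ v, xi₃ v, fderiv ℝ defect (pVI v), ContinuousLinearMap.proj 1]
  have hinj : (Λ : Phase →ₗ[ℝ] (Fin 5 → ℝ)).ker = ⊥ := by
    rw [LinearMap.ker_eq_bot']
    intro u hu
    have e0 : xi₁ v u = 0 := congrFun hu 0
    have e1 : xi₂ v u = 0 := congrFun hu 1
    have e2 : xi₃ v u = 0 := congrFun hu 2
    have e3 : fderiv ℝ defect (pVI v) u = 0 := congrFun hu 3
    have e4 : u 1 = 0 := congrFun hu 4
    rw [xi₁_apply, e4] at e0
    rw [xi₂_apply] at e1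
    rw [xi₃_apply] at e2
    rw [fderiv_defect_pVI hv, div_eq_zero_iff, or_iff_left hv0.ne'] at e3
    have hpos : 0 < √3 * √(4 * v ^ 2 - 1) / (8 * v ^ 2 + 1) := by positivity
    have u2 : u 2 = 0 := by
      have : √3 * √(4 * v ^ 2 - 1) / (8 * v ^ 2 + 1) * u 2 = 0 := by linarith
      exact (mul_eq_zero.1 this).resolve_left hpos.ne'
    have hb : u 3 - u 4 = 0 := by
      have : (√(4 * v ^ 2 - 1) + 2 / √(4 * v ^ 2 - 1)) * (u 3 - u 4) = 0 := by
        linear_combination e2 - e3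
      exact (mul_eq_zero.1 this).resolve_left (by positivity)
    rw [u2] at e1
    rw [hb] at e3
    ext i
    fin_cases i
    · simpa using e3
    · exact e4
    · exact u2
    · show u 3 = 0
      linarith
    · show u 4 = 0
      linarith
  obtain ⟨K, hK, hΛ⟩ := LinearMap.exists_antilipschitzWith _ hinj
  refine ⟨((K : ℝ) ^ 2)⁻¹, by positivity, fun u hu => ?_⟩
  set Q := xi₁ v u ^ 2 + xi₂ v u ^ 2 + xi₃ v u ^ 2 + fderiv ℝ defect (pVI v) u ^ 2 with hQ
  have hQ0 : 0 ≤ Q := by positivity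
  have h1 : ‖u‖ ≤ K * ‖Λ u‖ := by simpa using hΛ.le_mul_dist u 0
  have h2 : ‖Λ u‖ ≤ √Q := by
    rw [pi_norm_le_iff_of_nonneg (Real.sqrt_nonneg _)]
    intro i
    refine Real.le_sqrt_of_sq_le ?_
    rw [Real.norm_eq_abs, sq_abs]
    fin_cases i
    · show xi₁ v u ^ 2 ≤ Q
      rw [hQ]
      nlinarith [sq_nonneg (xi₂ v u), sq_nonneg (xi₃ v u),
        sq_nonneg (fderiv ℝ defect (pVI v) u)]
    · show xi₂ v u ^ 2 ≤ Q
      rw [hQ]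
      nlinarith [sq_nonneg (xi₁ v u), sq_nonneg (xi₃ v u),
        sq_nonneg (fderiv ℝ defect (pVI v) u)]
    · show xi₃ v u ^ 2 ≤ Q
      rw [hQ]
      nlinarith [sq_nonneg (xi₁ v u), sq_nonneg (xi₂ v u),
        sq_nonneg (fderiv ℝ defect (pVI v) u)]
    · show fderiv ℝ defect (pVI v) u ^ 2 ≤ Q
      rw [hQ]; nlinarith [sq_nonneg (xi₁ v u), sq_nonneg (xi₂ v u), sq_nonneg (xi₃ v u)]
    · show u 1 ^ 2 ≤ Q
      rw [hu]; simpa using hQ0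
  have h3 : ‖u‖ ^ 2 ≤ (K : ℝ) ^ 2 * Q := by
    calc ‖u‖ ^ 2 ≤ (K * √Q) ^ 2 := by gcongr; exact h1.trans (by gcongr)
      _ = _ := by rw [mul_pow, Real.sq_sqrt hQ0]
  rw [inv_mul_le_iff₀ (by positivity)]
  exact h3

set_option maxHeartbeats 1000000 in
/-- A constrained solution that converges to the equilibrium eventually lies on the invariant curve:
the distance to the curve, measured by a quadratic form in the unstable directions, cannot
decrease, and it tends to zero. The remaining normal direction is excluded by the constraint. -/
theorem eventually_mem_curve (hv : v ∈ Ioo (1 / 2 : ℝ) 1) {δ : ℝ} {c : ℝ → Phase} (hδ : 0 < δ)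
    (hsm : ContDiffOn ℝ ∞ c (Ioo (-δ) δ)) (hc0 : c 0 = pVI v) (hcd : HasDerivAt c (eSS v) 0)
    (hc1 : ∀ s ∈ Ioo (-δ) δ, c s 1 = s)
    (hode : ∀ s ∈ Ioo (-δ) δ, field v (c s) 1 • deriv c s = field v (c s))
    (hM : ∀ s ∈ Ioo (-δ) δ, c s ∈ constraintSet) {x : ℝ → Phase}
    (hx : IsForwardSolution (field v) constraintSet x) (hlim : Tendsto x atTop (𝓝 (pVI v))) :
    ∀ᶠ t in atTop, x t 1 ∈ Ioo (-δ) δ ∧ x t = c (x t 1) := by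
  have hv0 := pos_of_mem hv
  have hs0 := sqrt_pos_of_mem hv
  have hs2 := sq_sqrt_of_mem hv
  have h0mem : (0 : ℝ) ∈ Ioo (-δ) δ := ⟨by linarith, hδ⟩
  have hcs : ContDiffAt ℝ ∞ c 0 := hsm.contDiffAt (isOpen_Ioo.mem_nhds h0mem)
  set d : ℝ → Phase := fun t => x t - c (x t 1) with hd
  have hx1 : Tendsto (fun t => x t 1) atTop (𝓝 0) := by
    have := tendsto_pi_nhds.1 hlim 1
    simpa [pVI] using this
  have hcx : Tendsto (fun t => c (x t 1)) atTop (𝓝 (pVI v)) := by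
    rw [← hc0]
    exact hcs.continuousAt.tendsto.comp hx1
  have hpair : Tendsto (fun t => (x t, c (x t 1))) atTop (𝓝 (pVI v, pVI v)) := hlim.prodMk_nhds hcx
  have hd0 : Tendsto d atTop (𝓝 0) := by simpa using hlim.sub hcx
  have hder : Tendsto (fun t => deriv c (x t 1)) atTop (𝓝 (eSS v)) := by
    rw [← hcd.deriv]
    exact ((hcs.derivWithin (m := 0) (by simp)).continuousAt).tendsto.comp hx1
  obtain ⟨κ, hκ, hκ'⟩ := exists_mul_sq_norm_le hv
  set s := √(4 * v ^ 2 - 1) with hs_def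
  set a : ℝ := s ^ 2 / v with ha
  set b : ℝ := √3 * s / v with hb
  set k : ℝ := s / √3 with hk
  have h3 : √3 ^ 2 = (3 : ℝ) := Real.sq_sqrt (by norm_num)
  have h30 : (0 : ℝ) < √3 := by positivity
  have ha0 : 0 < a := by positivity
  have hkb : k * b = a := by rw [hk, hb, ha]; field_simp
  have hk0 : 0 ≤ k := by positivity
  have hk1 : k ≤ 1 := by
    rw [hk, div_le_one h30]
    exact le_of_sq_le_sq (by nlinarith [hv.2]) h30.le
  set L : ℝ := ‖xi₁ v‖ + ‖xi₂ v‖ + ‖xi₃ v‖ with hL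
  have hL₁ : ‖xi₁ v‖ ≤ L := by rw [hL]; nlinarith [norm_nonneg (xi₂ v), norm_nonneg (xi₃ v)]
  have hL₂ : ‖xi₂ v‖ ≤ L := by rw [hL]; nlinarith [norm_nonneg (xi₁ v), norm_nonneg (xi₃ v)]
  have hL₃ : ‖xi₃ v‖ ≤ L := by rw [hL]; nlinarith [norm_nonneg (xi₁ v), norm_nonneg (xi₂ v)]
  have hL0 : 0 ≤ L := (norm_nonneg _).trans hL₁
  set m : ℝ := L + ‖linMap v‖ + 1 with hm
  have hm0 : 0 < m := by positivity
  obtain ⟨η, hη0, hη1, hηκ, hηa⟩ : ∃ η : ℝ, 0 < η ∧ η ≤ 1 ∧ η ^ 2 ≤ κ / 4 ∧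
      8 * (L * (η * m)) ≤ a * (κ / 4) := by
    have h1 : Tendsto (fun η : ℝ => η ^ 2) (𝓝[>] 0) (𝓝 (0 ^ 2)) :=
      ((continuous_pow 2).tendsto 0).mono_left nhdsWithin_le_nhds
    have h2 : Tendsto (fun η : ℝ => 8 * (L * (η * m))) (𝓝[>] 0) (𝓝 (8 * (L * (0 * m)))) :=
      (Continuous.tendsto (by fun_prop) 0).mono_left nhdsWithin_le_nhds
    rw [zero_pow two_ne_zero] at h1
    rw [zero_mul, mul_zero, mul_zero] at h2
    obtain ⟨η, h3, h4, h5⟩ := ((h1.eventually_lt_const (show 0 < κ / 4 by positivity)).and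
      ((h2.eventually_lt_const (show 0 < a * (κ / 4) by positivity)).and
        (Ioo_mem_nhdsGT one_pos))).exists
    exact ⟨η, h5.1, h5.2.le, h3.le, h4.le⟩
  -- strict differentiability at the equilibrium bounds all error terms by `η ‖d t‖`
  have ev1 : ∀ᶠ t in atTop, ‖field v (x t) - field v (c (x t 1)) - linMap v (d t)‖ ≤ η * ‖d t‖ :=
    ((hasStrictFDerivAt_field hv).isLittleO.comp_tendsto hpair).def hη0
  have hstr : HasStrictFDerivAt defect (fderiv ℝ defect (pVI v)) (pVI v) :=
    contDiff_defect.contDiffAt.hasStrictFDerivAt (by simp)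
  have ev2 : ∀ᶠ t in atTop, ‖defect (x t) - defect (c (x t 1)) - fderiv ℝ defect (pVI v) (d t)‖
      ≤ η * ‖d t‖ := (hstr.isLittleO.comp_tendsto hpair).def hη0
  have ev3 : ∀ ξ : Phase →L[ℝ] ℝ, ξ (eSS v) = 0 → ∀ᶠ t in atTop, |ξ (deriv c (x t 1))| ≤ η := by
    intro ξ hξ
    have h1 := ((ξ.continuous.tendsto _).comp hder).abs
    rw [hξ, abs_zero] at h1
    filter_upwards [h1.eventually_lt_const hη0] with t ht using ht.le
  obtain ⟨hx₁, hx₂, hx₃⟩ := xi_eSS hv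
  have evall := ev1.and (ev2.and ((ev3 _ hx₁).and ((ev3 _ hx₂).and ((ev3 _ hx₃).and
    ((hx1.eventually (isOpen_Ioo.mem_nhds h0mem)).and (eventually_gt_atTop 0))))))
  obtain ⟨T, hT⟩ := eventually_atTop.1 evall
  set V : ℝ → ℝ := fun t => xi₁ v (d t) ^ 2 + k * (xi₁ v (d t) * xi₂ v (d t)) + xi₂ v (d t) ^ 2
    + xi₃ v (d t) ^ 2 with hV
  -- the constraint makes the component of `d` normal to the constraint set negligible
  have hlow : ∀ t ≥ T, κ / 4 * ‖d t‖ ^ 2 ≤ V t := by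
    intro t ht
    obtain ⟨-, h2, -, -, -, h6, h7⟩ := hT t ht
    rw [mem_constraintSet_iff.1 (hx t h7.le).2, mem_constraintSet_iff.1 (hM _ h6), sub_zero,
      zero_sub, norm_neg, Real.norm_eq_abs] at h2
    have hd1 : d t 1 = 0 := by
      rw [hd]
      exact sub_eq_zero.2 (hc1 _ h6).symm
    have h8 := hκ' (d t) hd1
    have h9 : fderiv ℝ defect (pVI v) (d t) ^ 2 ≤ κ / 4 * ‖d t‖ ^ 2 := by
      rw [← sq_abs]
      calc _ ≤ (η * ‖d t‖) ^ 2 := by gcongr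
        _ = η ^ 2 * ‖d t‖ ^ 2 := by ring
        _ ≤ _ := by gcongr
    have h10 : (xi₁ v (d t) ^ 2 + xi₂ v (d t) ^ 2 + xi₃ v (d t) ^ 2) / 2 ≤ V t := by
      rw [hV]
      have := mul_nonneg hk0 (sq_nonneg (xi₁ v (d t) + xi₂ v (d t)))
      nlinarith [sq_nonneg (xi₁ v (d t)), sq_nonneg (xi₂ v (d t)), sq_nonneg (xi₃ v (d t))]
    nlinarith [sq_nonneg ‖d t‖]
  have hderiv : ∀ t ≥ T, ∃ V', 0 ≤ V' ∧ HasDerivAt V V' t := by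
    intro t ht
    obtain ⟨h1, -, h3', h4, h5, h6, h7⟩ := hT t ht
    have hxd : HasDerivAt x (field v (x t)) t := (hx t h7.le).1.hasDerivAt (Ici_mem_nhds h7)
    have hcd' : HasDerivAt c (deriv c (x t 1)) (x t 1) :=
      ((hsm.contDiffAt (isOpen_Ioo.mem_nhds h6)).differentiableAt (by simp)).hasDerivAt
    have hdd : HasDerivAt d (field v (x t) - field v (x t) 1 • deriv c (x t 1)) t :=
      hxd.sub (HasDerivAt.scomp (g₁ := c) (h := fun t => x t 1) t hcd' (hasDerivAt_pi.1 hxd 1))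
    set R := field v (x t) - field v (c (x t 1)) - linMap v (d t) with hR
    set w := field v (x t) 1 - field v (c (x t 1)) 1 with hw
    have hd' : field v (x t) - field v (x t) 1 • deriv c (x t 1) =
        linMap v (d t) + (R - w • deriv c (x t 1)) := by
      have := hode _ h6
      rw [hR, hw, sub_smul, this]
      abel
    rw [hd'] at hdd
    have hwb : |w| ≤ (‖linMap v‖ + 1) * ‖d t‖ := by
      have e1 : |w| ≤ ‖field v (x t) - field v (c (x t 1))‖ :=
        norm_le_pi_norm (field v (x t) - field v (c (x t 1))) 1
      have e2 : field v (x t) - field v (c (x t 1)) = R + linMap v (d t) := by rw [hR]; abel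
      rw [e2] at e1
      have e3 := (norm_add_le R (linMap v (d t))).trans (add_le_add h1 ((linMap v).le_opNorm (d t)))
      have e4 : η * ‖d t‖ ≤ 1 * ‖d t‖ := by gcongr
      linarith
    have hρ : ∀ ξ : Phase →L[ℝ] ℝ, ‖ξ‖ ≤ L → |ξ (deriv c (x t 1))| ≤ η →
        |ξ (R - w • deriv c (x t 1))| ≤ η * m * ‖d t‖ := by
      intro ξ hξ hξ'
      rw [map_sub, map_smul, smul_eq_mul]
      have e1 : |ξ R| ≤ L * (η * ‖d t‖) := ξ.le_of_opNorm_le_of_le hξ h1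
      have e2 : |w * ξ (deriv c (x t 1))| ≤ (‖linMap v‖ + 1) * ‖d t‖ * η := by
        rw [abs_mul]
        gcongr
      calc _ ≤ |ξ R| + |w * ξ (deriv c (x t 1))| := abs_sub _ _
        _ ≤ L * (η * ‖d t‖) + (‖linMap v‖ + 1) * ‖d t‖ * η := add_le_add e1 e2
        _ = _ := by rw [hm]; ring
    have hξd : ∀ ξ : Phase →L[ℝ] ℝ, HasDerivAt (fun t => ξ (d t))
        (ξ (linMap v (d t)) + ξ (R - w • deriv c (x t 1))) t := by
      intro ξ
      rw [← map_add]
      exact ξ.hasFDerivAt.comp_hasDerivAt t hdd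
    have hξn : ∀ ξ : Phase →L[ℝ] ℝ, ‖ξ‖ ≤ L → |ξ (d t)| ≤ L * ‖d t‖ := fun ξ hξ =>
      ξ.le_of_opNorm_le hξ _
    obtain ⟨l₁, l₂, l₃⟩ := xi_linMap hv (d t)
    have hd₁ := hξd (xi₁ v)
    have hd₂ := hξd (xi₂ v)
    have hd₃ := hξd (xi₃ v)
    rw [l₁] at hd₁
    rw [l₂] at hd₂
    rw [l₃] at hd₃
    refine ⟨_, quadForm_deriv_nonneg (b := b) (N := ‖d t‖) hkb hk0 hk1 ha0.le (hξn _ hL₁)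
      (hξn _ hL₂) (hξn _ hL₃) (hρ _ hL₁ h3') (hρ _ hL₂ h4) (hρ _ hL₃ h5) (hlow t ht) hηa, ?_⟩
    refine (((hd₁.pow 2).add ((hd₁.mul hd₂).const_mul k)).add (hd₂.pow 2)).add (hd₃.pow 2)
      |>.congr_deriv ?_
    push_cast
    ring
  have hmono : MonotoneOn V (Ici T) := by
    choose! V' hV' hVd using hderiv
    refine monotoneOn_of_hasDerivWithinAt_nonneg (convex_Ici T)
      (fun t ht => (hVd t ht).continuousAt.continuousWithinAt)
      (fun t ht => (hVd t (interior_subset ht)).hasDerivWithinAt)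
      (fun t ht => hV' t (interior_subset ht))
  have hVlim : Tendsto V atTop (𝓝 0) := by
    have hcont : Continuous fun u : Phase => xi₁ v u ^ 2 + k * (xi₁ v u * xi₂ v u) + xi₂ v u ^ 2
      + xi₃ v u ^ 2 := by fun_prop
    have := (hcont.tendsto 0).comp hd0
    simpa [Function.comp_def] using this
  filter_upwards [eventually_ge_atTop T] with t ht
  refine ⟨(hT t ht).2.2.2.2.2.1, ?_⟩
  have hle : V t ≤ 0 := ge_of_tendsto hVlim (by
    filter_upwards [eventually_ge_atTop t] with u hu
    exact hmono ht (ht.trans hu) hu)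
  have h1 := (hlow t ht).trans hle
  have h2 : ‖d t‖ ^ 2 ≤ 0 := by
    by_contra hcon
    have := mul_pos (show 0 < κ / 4 by positivity) (not_le.1 hcon)
    linarith
  have h4 : ‖d t‖ = 0 := pow_eq_zero_iff two_ne_zero |>.1 (le_antisymm h2 (by positivity))
  exact sub_eq_zero.1 (norm_eq_zero.1 h4)

end Bianchi

/-! ### Uniqueness for autonomous and for linear equations -/

theorem HasDerivWithinAt.ici_of_icc {E : Type*} [NormedAddCommGroup E] [NormedSpace ℝ E]
    {f : ℝ → E} {f' : E} {a b t : ℝ} (h : HasDerivWithinAt f f' (Icc a b) t) (ht : t ∈ Ico a b) :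
    HasDerivWithinAt f f' (Ici t) t :=
  h.mono_of_mem_nhdsWithin (mem_of_superset (Icc_mem_nhdsGE ht.2) (Icc_subset_Icc_left ht.1))

theorem HasDerivWithinAt.iic_of_icc {E : Type*} [NormedAddCommGroup E] [NormedSpace ℝ E]
    {f : ℝ → E} {f' : E} {a b t : ℝ} (h : HasDerivWithinAt f f' (Icc a b) t) (ht : t ∈ Ioc a b) :
    HasDerivWithinAt f f' (Iic t) t :=
  h.mono_of_mem_nhdsWithin (mem_of_superset (Icc_mem_nhdsLE ht.1) (Icc_subset_Icc_right ht.2))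

/-- A smooth map is Lipschitz on a ball that contains two given continuous curves. -/
theorem exists_lipschitzOnWith_of_continuousOn {E : Type*} [NormedAddCommGroup E]
    [NormedSpace ℝ E] [ProperSpace E] {F : E → E} (hF : ContDiff ℝ ∞ F) {f g : ℝ → E} {a b : ℝ}
    (hf : ContinuousOn f (Icc a b)) (hg : ContinuousOn g (Icc a b)) :
    ∃ (K : NNReal) (S : Set E), LipschitzOnWith K F S ∧ (∀ t ∈ Icc a b, f t ∈ S) ∧
      ∀ t ∈ Icc a b, g t ∈ S := by
  obtain ⟨R, hR⟩ := ((isCompact_Icc.image_of_continuousOn hf).isBounded.union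
    (isCompact_Icc.image_of_continuousOn hg).isBounded).subset_closedBall 0
  obtain ⟨K, hK⟩ := hF.contDiffOn.exists_lipschitzOnWith (s := Metric.closedBall (0 : E) R)
    (by simp) (convex_closedBall 0 R) (isCompact_closedBall 0 R)
  exact ⟨K, _, hK, fun t ht => hR (Or.inl (mem_image_of_mem f ht)),
    fun t ht => hR (Or.inr (mem_image_of_mem g ht))⟩

theorem eqOn_Icc_of_eq_right {E : Type*} [NormedAddCommGroup E] [NormedSpace ℝ E] [ProperSpace E]
    {F : E → E} (hF : ContDiff ℝ ∞ F) {f g : ℝ → E} {a b : ℝ}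
    (hf : ∀ t ∈ Icc a b, HasDerivWithinAt f (F (f t)) (Icc a b) t)
    (hg : ∀ t ∈ Icc a b, HasDerivWithinAt g (F (g t)) (Icc a b) t) (hb : f b = g b) :
    EqOn f g (Icc a b) := by
  have hfc : ContinuousOn f (Icc a b) := fun t ht => (hf t ht).continuousWithinAt
  have hgc : ContinuousOn g (Icc a b) := fun t ht => (hg t ht).continuousWithinAt
  obtain ⟨K, S, hK, hfS, hgS⟩ := exists_lipschitzOnWith_of_continuousOn hF hfc hgc
  exact ODE_solution_unique_of_mem_Icc_left (v := fun _ => F) (s := fun _ => S) (fun _ _ => hK)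
    hfc (fun t ht => (hf t (Ioc_subset_Icc_self ht)).iic_of_icc ht)
    (fun t ht => hfS t (Ioc_subset_Icc_self ht)) hgc
    (fun t ht => (hg t (Ioc_subset_Icc_self ht)).iic_of_icc ht)
    (fun t ht => hgS t (Ioc_subset_Icc_self ht)) hb

theorem eqOn_Icc_of_eq_left {E : Type*} [NormedAddCommGroup E] [NormedSpace ℝ E] [ProperSpace E]
    {F : E → E} (hF : ContDiff ℝ ∞ F) {f g : ℝ → E} {a b : ℝ}
    (hf : ∀ t ∈ Icc a b, HasDerivWithinAt f (F (f t)) (Icc a b) t)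
    (hg : ∀ t ∈ Icc a b, HasDerivWithinAt g (F (g t)) (Icc a b) t) (ha : f a = g a) :
    EqOn f g (Icc a b) := by
  have hfc : ContinuousOn f (Icc a b) := fun t ht => (hf t ht).continuousWithinAt
  have hgc : ContinuousOn g (Icc a b) := fun t ht => (hg t ht).continuousWithinAt
  obtain ⟨K, S, hK, hfS, hgS⟩ := exists_lipschitzOnWith_of_continuousOn hF hfc hgc
  exact ODE_solution_unique_of_mem_Icc_right (v := fun _ => F) (s := fun _ => S) (fun _ _ => hK)
    hfc (fun t ht => (hf t (Ico_subset_Icc_self ht)).ici_of_icc ht)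
    (fun t ht => hfS t (Ico_subset_Icc_self ht)) hgc
    (fun t ht => (hg t (Ico_subset_Icc_self ht)).ici_of_icc ht)
    (fun t ht => hgS t (Ico_subset_Icc_self ht)) ha

/-- A solution of a scalar linear homogeneous equation that vanishes at the right end point vanishes
identically. -/
theorem eq_zero_of_linear_of_eq_zero_right {γ m : ℝ → ℝ} {a b : ℝ} (hm : ContinuousOn m (Icc a b))
    (hγ : ∀ t ∈ Icc a b, HasDerivWithinAt γ (m t * γ t) (Icc a b) t) (hb : γ b = 0) :
    ∀ t ∈ Icc a b, γ t = 0 := by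
  obtain ⟨C, hC⟩ := isCompact_Icc.exists_bound_of_continuousOn hm
  refine ODE_solution_unique_of_mem_Icc_left (v := fun t y => m t * y) (s := fun _ => univ)
    (K := C.toNNReal) (g := fun _ => 0) (fun t ht => ?_)
    (fun t ht => (hγ t ht).continuousWithinAt)
    (fun t ht => (hγ t (Ioc_subset_Icc_self ht)).iic_of_icc ht) (fun _ _ => mem_univ _)
    continuousOn_const (fun t _ => by simpa using hasDerivWithinAt_const t (Iic t) (0 : ℝ))
    (fun _ _ => mem_univ _) hb
  refine LipschitzOnWith.of_dist_le_mul fun x _ y _ => ?_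
  rw [Real.dist_eq, Real.dist_eq, ← mul_sub, abs_mul]
  gcongr
  exact (hC t (Ioc_subset_Icc_self ht)).trans (Real.le_coe_toNNReal C)

/-! ### Solutions on intervals -/

section ForwardSolution

variable {F : Phase → Phase} {M : Set Phase} {x : ℝ → Phase} {p q : Phase}

theorem IsForwardSolution.comp_add (hx : IsForwardSolution F M x) {T : ℝ} (hT : 0 ≤ T) :
    IsForwardSolution F M fun t => x (t + T) := by
  intro t ht
  obtain ⟨h1, h2⟩ := hx (t + T) (by linarith)
  refine ⟨?_, h2⟩
  have h3 : HasDerivWithinAt (fun t : ℝ => t + T) 1 (Ici 0) t :=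
    ((hasDerivAt_id t).add_const T).hasDerivWithinAt
  have h4 := HasDerivWithinAt.scomp (g₁ := x) t h1 h3
    (fun u (hu : 0 ≤ u) => (by simpa using add_nonneg hu hT : u + T ∈ Ici (0 : ℝ)))
  simpa [Function.comp_def] using h4

theorem IsForwardSolution.hasDerivWithinAt_Icc (hx : IsForwardSolution F M x) {a b : ℝ}
    (ha : 0 ≤ a) : ∀ t ∈ Icc a b, HasDerivWithinAt x (F (x t)) (Icc a b) t :=
  fun t ht => (hx t (ha.trans ht.1)).1.mono fun _ hu => ha.trans hu.1

theorem IsForwardSolution.continuousOn (hx : IsForwardSolution F M x) : ContinuousOn x (Ici 0) :=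
  fun t ht => (hx t ht).1.continuousWithinAt

theorem isForwardSolution_const (hF : F p = 0) (hp : p ∈ M) :
    IsForwardSolution F M fun _ => p :=
  fun t _ => ⟨by simpa [hF] using hasDerivWithinAt_const t (Ici 0) p, hp⟩

/-- Forward solutions of a smooth field are determined by their initial value. -/
theorem IsForwardSolution.eq_of_eq (hF : ContDiff ℝ ∞ F) {y : ℝ → Phase}
    (hx : IsForwardSolution F M x) (hy : IsForwardSolution F M y) (h0 : x 0 = y 0) {t : ℝ}
    (ht : 0 ≤ t) : x t = y t :=
  eqOn_Icc_of_eq_left hF (hx.hasDerivWithinAt_Icc le_rfl) (hy.hasDerivWithinAt_Icc le_rfl) h0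
    ⟨ht, le_rfl⟩

/-- Forward solutions of a smooth field that meet at the same time agree before it. -/
theorem IsForwardSolution.eq_zero_of_eq (hF : ContDiff ℝ ∞ F) {y : ℝ → Phase}
    (hx : IsForwardSolution F M x) (hy : IsForwardSolution F M y) {t : ℝ} (ht : 0 ≤ t)
    (h : x t = y t) : x 0 = y 0 :=
  eqOn_Icc_of_eq_right hF (hx.hasDerivWithinAt_Icc le_rfl) (hy.hasDerivWithinAt_Icc le_rfl) h
    ⟨le_rfl, ht⟩

end ForwardSolution

namespace Bianchi

/-! ### Strict monotonicity of `N₁ N₂ N₃` -/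

/-- At a point of the constraint set at which `Σ₊`, `Σ₋` and their derivatives vanish, one of the
`Nᵢ` vanishes. -/
theorem prodN_eq_zero_of_sigma_eq_zero {x : Phase} (hx : x ∈ constraintSet) (h0 : x 0 = 0)
    (h1 : x 1 = 0) (hp : curvPlus x = 0) (hm : curvMinus x = 0) : prodN x = 0 := by
  simp only [constraintSet, mem_ofPred_eq, sigmaSq, h0, h1] at hx
  simp only [curvPlus] at hp
  simp only [curvMinus, mul_eq_zero] at hm
  have h3 : √3 ≠ (0 : ℝ) := by positivity
  simp only [OfNat.ofNat_ne_zero, h3, or_false, false_or] at hm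
  rw [prodN]
  rcases hm with hm | hm
  · have h43 : x 4 = x 3 := sub_eq_zero.1 hm
    rw [h43] at hp hx
    have : x 2 * (x 2 - x 3) = 0 := by linear_combination (-1 / 4 : ℝ) * hp
    rcases mul_eq_zero.1 this with h | h
    · rw [h]; ring
    · have h23 : x 2 = x 3 := sub_eq_zero.1 h
      rw [h23] at hx
      nlinarith [sq_nonneg (x 3)]
  · have h2 : x 2 = x 3 + x 4 := by linear_combination hm
    rw [h2] at hp
    rw [h2]
    linear_combination (-(x 3 + x 4) / 8) * hp

variable {v : ℝ}

/-- Along a constrained solution the sign of `N₁ N₂ N₃` is preserved, and its square decreases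
strictly unless it vanishes: it is stationary only where `Σ₊ = Σ₋ = 0`, which cannot persist. -/
theorem prodN_strict (hv : 0 < v) {x : ℝ → Phase} {a b : ℝ} (hab : a < b)
    (hx : ∀ t ∈ Icc a b, HasDerivWithinAt x (field v (x t)) (Icc a b) t ∧ x t ∈ constraintSet)
    (ha : prodN (x a) ≠ 0) :
    0 < prodN (x a) * prodN (x b) ∧ prodN (x b) ^ 2 < prodN (x a) ^ 2 := by
  have hxc : ContinuousOn x (Icc a b) := fun t ht => (hx t ht).1.continuousWithinAt
  have hσ : Continuous sigmaSq := by unfold sigmaSq; fun_prop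
  have hD : ∀ t ∈ Icc a b, HasDerivWithinAt (fun t => prodN (x t))
      (-(12 * v * sigmaSq (x t)) * prodN (x t)) (Icc a b) t := by
    intro t ht
    rw [← fderiv_prodN_field]
    exact hasDerivWithinAt_comp_of_contDiff contDiff_prodN (hx t ht).1
  have hne : ∀ t ∈ Icc a b, prodN (x t) ≠ 0 := by
    intro t ht h0
    have hsub : Icc a t ⊆ Icc a b := Icc_subset_Icc_right ht.2
    exact ha (eq_zero_of_linear_of_eq_zero_right (γ := fun t => prodN (x t))
      (m := fun t => -(12 * v * sigmaSq (x t)))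
      (((hσ.comp_continuousOn (hxc.mono hsub)).const_smul (12 * v)).neg)
      (fun u hu => (hD u (hsub hu)).mono hsub) h0 a ⟨le_rfl, ht.1⟩)
  have hE : ∀ t ∈ Icc a b, HasDerivWithinAt (fun t => prodN (x t) ^ 2)
      (-(24 * v * sigmaSq (x t)) * prodN (x t) ^ 2) (Icc a b) t := fun t ht =>
    ((hD t ht).pow 2).congr_deriv (by push_cast; ring)
  have hσ0 : ∀ y : Phase, 0 ≤ sigmaSq y := fun y => by unfold sigmaSq; positivity
  have hanti : AntitoneOn (fun t => prodN (x t) ^ 2) (Icc a b) := by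
    refine antitoneOn_of_hasDerivWithinAt_nonpos (convex_Icc a b)
      (fun t ht => (hE t ht).continuousWithinAt)
      (fun t ht => (hE t (interior_subset ht)).mono interior_subset) (fun t ht => ?_)
    have := hσ0 (x t)
    rw [neg_mul, neg_nonpos]
    positivity
  have ha' : a ∈ Icc a b := ⟨le_rfl, hab.le⟩
  have hb' : b ∈ Icc a b := ⟨hab.le, le_rfl⟩
  constructor
  · by_contra hneg
    have hDc : ContinuousOn (fun t => prodN (x t)) (Icc a b) :=
      fun t ht => (hD t ht).continuousWithinAt
    have h0 : (0 : ℝ) ∈ uIcc (prodN (x a)) (prodN (x b)) := by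
      rw [mem_uIcc]
      rcases lt_or_gt_of_ne ha with h | h
      · left
        exact ⟨h.le, by nlinarith⟩
      · right
        exact ⟨by nlinarith, h.le⟩
    rw [← uIcc_of_le hab.le] at hDc
    obtain ⟨t, ht, ht0⟩ := intermediate_value_uIcc hDc h0
    rw [uIcc_of_le hab.le] at ht
    exact hne t ht ht0
  · by_contra hcon
    have hconst : ∀ t ∈ Icc a b, prodN (x t) ^ 2 = prodN (x a) ^ 2 := fun t ht =>
      le_antisymm (hanti ha' ht ht.1) ((not_lt.1 hcon).trans (hanti ht hb' ht.2))
    have hσx : ∀ t ∈ Ioo a b, sigmaSq (x t) = 0 := by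
      intro t ht
      have ht' := Ioo_subset_Icc_self ht
      have h1 := (hE t ht').hasDerivAt (Icc_mem_nhds ht.1 ht.2)
      have h2 : HasDerivAt (fun t => prodN (x t) ^ 2) 0 t :=
        (hasDerivAt_const t (prodN (x a) ^ 2)).congr_of_eventuallyEq (by
          filter_upwards [Icc_mem_nhds ht.1 ht.2] with u hu using hconst u hu)
      have h3 := h1.unique h2
      have h4 := pow_ne_zero 2 (hne t ht')
      have h5 : -(24 * v * sigmaSq (x t)) = 0 := (mul_eq_zero.1 h3).resolve_right h4
      have h6 : (24 * v) * sigmaSq (x t) = 0 := by linarith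
      exact (mul_eq_zero.1 h6).resolve_left (by positivity)
    have hx0 : ∀ t ∈ Ioo a b, x t 0 = 0 ∧ x t 1 = 0 := by
      intro t ht
      have := hσx t ht
      unfold sigmaSq at this
      exact ⟨by nlinarith [sq_nonneg (x t 0), sq_nonneg (x t 1)],
        by nlinarith [sq_nonneg (x t 0), sq_nonneg (x t 1)]⟩
    obtain ⟨t, ht⟩ := exists_between hab
    have ht' : t ∈ Ioo a b := ht
    have htI := Ioo_subset_Icc_self ht'
    have hd := (hx t htI).1.hasDerivAt (Icc_mem_nhds ht.1 ht.2)
    have hcoord : ∀ i : Fin 5, (∀ u ∈ Ioo a b, x u i = 0) → field v (x t) i = 0 := fun i hi =>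
      (hasDerivAt_pi.1 hd i).unique ((hasDerivAt_const t (0 : ℝ)).congr_of_eventuallyEq (by
        filter_upwards [isOpen_Ioo.mem_nhds ht'] with u hu using hi u hu))
    have f0 := hcoord 0 fun u hu => (hx0 u hu).1
    have f1 := hcoord 1 fun u hu => (hx0 u hu).2
    simp [field, (hx0 t ht').1, (hx0 t ht').2] at f0 f1
    exact hne t htI (prodN_eq_zero_of_sigma_eq_zero (hx t htI).2 (hx0 t ht').1 (hx0 t ht').2 f0 f1)

theorem prodN_strict_of_isForwardSolution (hv : 0 < v) {x : ℝ → Phase}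
    (hx : IsForwardSolution (field v) constraintSet x) {a b : ℝ} (ha0 : 0 ≤ a) (hab : a < b)
    (ha : prodN (x a) ≠ 0) :
    0 < prodN (x a) * prodN (x b) ∧ prodN (x b) ^ 2 < prodN (x a) ^ 2 :=
  prodN_strict hv hab (fun t ht => ⟨hx.hasDerivWithinAt_Icc ha0 t ht, (hx t (ha0.trans ht.1)).2⟩) ha

theorem prodN_eq_zero_of_isForwardSolution {x : ℝ → Phase}
    (hx : IsForwardSolution (field v) constraintSet x) (h0 : prodN (x 0) = 0) {t : ℝ}
    (ht : 0 ≤ t) : prodN (x t) = 0 := by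
  have hσ : Continuous sigmaSq := by unfold sigmaSq; fun_prop
  have hneg : ∀ u ∈ Icc (-t) 0, -u ∈ Ici (0 : ℝ) := fun u hu => by simpa using hu.2
  have hderiv : ∀ u ∈ Icc (-t) 0, HasDerivWithinAt (fun u => prodN (x (-u)))
      ((12 * v * sigmaSq (x (-u))) * prodN (x (-u))) (Icc (-t) 0) u := by
    intro u hu
    have h1 := hasDerivWithinAt_comp_of_contDiff contDiff_prodN (hx (-u) (hneg u hu)).1
    rw [fderiv_prodN_field] at h1
    have h2 := HasDerivWithinAt.scomp u h1
      ((hasDerivAt_neg u).hasDerivWithinAt (s := Icc (-t) 0)) hneg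
    simpa [Function.comp_def] using h2
  have := eq_zero_of_linear_of_eq_zero_right (γ := fun u => prodN (x (-u)))
    (m := fun u => 12 * v * sigmaSq (x (-u)))
    ((hσ.comp_continuousOn (hx.continuousOn.comp continuousOn_neg hneg)).const_smul (12 * v))
    hderiv (by simpa using h0) (-t) ⟨le_rfl, by linarith⟩
  simpa using this

/-! ### The stable set and its local curve -/

/-- The data of the local stable manifold: a smooth graph over `Σ₋` inside the stable set that
captures every constrained solution converging to the equilibrium. -/
structure IsLocalStableCurve (v δ : ℝ) (c : ℝ → Phase) : Prop where
  pos : 0 < δ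
  contDiffOn : ContDiffOn ℝ ∞ c (Ioo (-δ) δ)
  map_zero : c 0 = pVI v
  hasDerivAt_zero : HasDerivAt c (eSS v) 0
  coord_one : ∀ s ∈ Ioo (-δ) δ, c s 1 = s
  strictAntiOn : StrictAntiOn (fun s => prodN (c s)) (Ioo (-δ) δ)
  mem_strongStableSet : ∀ s ∈ Ioo (-δ) δ, c s ∈ Wss v
  eventually_mem : ∀ x : ℝ → Phase, IsForwardSolution (field v) constraintSet x →
    Tendsto x atTop (𝓝 (pVI v)) → ∀ᶠ t in atTop, x t 1 ∈ Ioo (-δ) δ ∧ x t = c (x t 1)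

theorem strongStableSet_subset_stableSet {F : Phase → Phase} {M : Set Phase} {p : Phase} {r : ℝ}
    (hr : r < 0) : strongStableSet F M p r ⊆ stableSet F M p := by
  rintro q ⟨x, hx, hq, hO⟩
  refine ⟨x, hx, hq, ?_⟩
  have hlim : Tendsto (fun t => Real.exp (r * t)) atTop (𝓝 0) :=
    Real.tendsto_exp_atBot.comp (tendsto_id.const_mul_atTop_of_neg hr)
  have := hO.trans_tendsto hlim
  simpa using this.add_const p

/-- The strong-stable set of the equilibrium is negatively invariant. -/
theorem mem_Wss_of_isForwardSolution {x : ℝ → Phase}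
    (hx : IsForwardSolution (field v) constraintSet x) {T : ℝ} (hT : 0 ≤ T) (h : x T ∈ Wss v) :
    x 0 ∈ Wss v := by
  obtain ⟨y, hy, hy0, hO⟩ := h
  refine ⟨x, hx, rfl, ?_⟩
  have heq : ∀ t, T ≤ t → x t = y (t - T) := fun t ht => by
    have := (hx.comp_add hT).eq_of_eq (contDiff_field v) hy (by simpa using hy0.symm)
      (sub_nonneg.2 ht)
    simpa using this
  have h1 : (fun t => y (t - T) - pVI v) =O[atTop] fun t => Real.exp (lamSS v * (t - T)) :=
    hO.comp_tendsto (tendsto_atTop_add_const_right _ (-T) tendsto_id)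
  have h2 : (fun t => Real.exp (lamSS v * (t - T))) =O[atTop] fun t => Real.exp (lamSS v * t) := by
    have : (fun t => Real.exp (lamSS v * (t - T))) =
        fun t => Real.exp (-(lamSS v * T)) * Real.exp (lamSS v * t) := by
      funext t
      rw [← Real.exp_add]
      ring_nf
    rw [this]
    exact (isBigO_refl _ _).const_mul_left _
  refine (h1.trans h2).congr' ?_ EventuallyEq.rfl
  filter_upwards [eventually_ge_atTop T] with t ht
  rw [heq t ht]

theorem exists_isLocalStableCurve (hv : v ∈ Ioo (1 / 2 : ℝ) 1) :
    ∃ δ c, IsLocalStableCurve v δ c := by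
  obtain ⟨r, h, hr, hsm, h0, he, hode, hM⟩ := exists_linearizing_curve hv
  obtain ⟨δ, c, hδ, hcs, hc0, hcd, hc1, hF, hanti, hch⟩ := exists_graph_curve hv hr hsm h0 he hode
  refine ⟨δ, c, hδ, hcs, hc0, hcd, hc1, hanti, fun s hs => ?_, fun x hx hlim =>
    eventually_mem_curve hv hδ hcs hc0 hcd hc1 hF (fun s hs => ?_) hx hlim⟩
  · obtain ⟨σ, hσ, hcσ⟩ := hch s hs
    exact ⟨_, isForwardSolution_comp_exp hv hode hM hσ, by simp [hcσ], isBigO_comp_exp hv h0 he σ⟩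
  · obtain ⟨σ, hσ, hcσ⟩ := hch s hs
    rw [hcσ]
    exact hM σ hσ

theorem IsLocalStableCurve.Wss_eq_stableSet (hv : v ∈ Ioo (1 / 2 : ℝ) 1) {δ : ℝ} {c : ℝ → Phase}
    (hc : IsLocalStableCurve v δ c) : Wss v = stableSet (field v) constraintSet (pVI v) := by
  refine Subset.antisymm (strongStableSet_subset_stableSet (lamSS_neg hv)) ?_
  rintro q ⟨x, hx, rfl, hlim⟩
  obtain ⟨T, ⟨hT1, hT2⟩, hT0⟩ := ((hc.eventually_mem x hx hlim).and (eventually_ge_atTop 0)).exists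
  refine mem_Wss_of_isForwardSolution hx hT0 ?_
  rw [hT2]
  exact hc.mem_strongStableSet _ hT1

theorem prodN_pVI (v : ℝ) : prodN (pVI v) = 0 := by
  simp [prodN, pVI]

/-- The function `N₁ N₂ N₃` separates the points of the stable set. Two solutions with the same
nonzero value enter the local curve on the same side of the equilibrium, hence their orbits merge,
and the value of `N₁ N₂ N₃` identifies the point on the common orbit. -/
theorem IsLocalStableCurve.injOn_prodN (hv : v ∈ Ioo (1 / 2 : ℝ) 1) {δ : ℝ} {c : ℝ → Phase}
    (hc : IsLocalStableCurve v δ c) :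
    InjOn prodN (stableSet (field v) constraintSet (pVI v)) := by
  have hv0 := pos_of_mem hv
  have hF := contDiff_field v
  have h0mem : (0 : ℝ) ∈ Ioo (-δ) δ := ⟨by linarith [hc.pos], hc.pos⟩
  have hinj : ∀ {y q : Phase}, y 1 ∈ Ioo (-δ) δ → y = c (y 1) → q 1 ∈ Ioo (-δ) δ → q = c (q 1) →
      prodN y = prodN q → y = q := by
    intro y q hy hy' hq hq' h
    have : y 1 = q 1 := hc.strictAntiOn.injOn hy hq (by rw [← hy', ← hq', h])
    rw [hy', hq', this]
  have hp1 : (pVI v) 1 ∈ Ioo (-δ) δ := by simpa [pVI] using h0mem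
  have hp2 : pVI v = c (pVI v 1) := by
    have : pVI v 1 = 0 := by simp [pVI]
    rw [this, hc.map_zero]
  have hzero : ∀ y : ℝ → Phase, IsForwardSolution (field v) constraintSet y →
      Tendsto y atTop (𝓝 (pVI v)) → prodN (y 0) = 0 → y 0 = pVI v := by
    intro y hy hlim h0
    obtain ⟨T, ⟨hT1, hT2⟩, hT0⟩ :=
      ((hc.eventually_mem y hy hlim).and (eventually_ge_atTop 0)).exists
    have h1 : y T = pVI v := hinj hT1 hT2 hp1 hp2
      (by rw [prodN_eq_zero_of_isForwardSolution hy h0 hT0, prodN_pVI])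
    exact hy.eq_zero_of_eq hF (isForwardSolution_const (field_pVI hv) (pVI_mem_constraintSet hv))
      hT0 h1
  -- the merging argument, for the solution that is closer to the equilibrium at a large time
  have hmerge : ∀ (y q : ℝ → Phase) (T : ℝ), IsForwardSolution (field v) constraintSet y →
      IsForwardSolution (field v) constraintSet q → Tendsto q atTop (𝓝 (pVI v)) → 0 < T →
      y T 1 ∈ Ioo (-δ) δ → y T = c (y T 1) → (∀ t ≥ T, q t 1 ∈ Ioo (-δ) δ ∧ q t = c (q t 1)) →
      prodN (y 0) ≠ 0 → prodN (y 0) = prodN (q 0) → prodN (y T) ^ 2 ≤ prodN (q T) ^ 2 →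
      y 0 = q 0 := by
    intro y q T hy hq hqlim hT hyT hyT' hqt hne h0 hle
    obtain ⟨hsy, -⟩ := prodN_strict_of_isForwardSolution hv0 hy le_rfl hT hne
    have hyT0 : prodN (y T) ≠ 0 := right_ne_zero_of_mul hsy.ne'
    have hlim2 : Tendsto (fun t => prodN (q t) ^ 2) atTop (𝓝 0) := by
      have := ((contDiff_prodN.continuous.tendsto _).comp hqlim).pow 2
      rw [prodN_pVI, zero_pow two_ne_zero] at this
      exact this
    obtain ⟨T', hT', hTT'⟩ := ((hlim2.eventually_lt_const
      (show 0 < prodN (y T) ^ 2 by positivity)).and (eventually_ge_atTop T)).exists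
    have hqc : ContinuousOn (fun t => prodN (q t) ^ 2) (Icc T T') :=
      (contDiff_prodN.continuous.comp_continuousOn
        (hq.continuousOn.mono fun u hu => hT.le.trans hu.1)).pow 2
    obtain ⟨t₂, ht₂, heq⟩ := intermediate_value_Icc' hTT' hqc ⟨hT'.le, hle⟩
    have hsq := (prodN_strict_of_isForwardSolution hv0 hq le_rfl (hT.trans_le ht₂.1)
      (by rwa [← h0])).1
    rw [← h0] at hsq
    have heq' : prodN (y T) = prodN (q t₂) := by
      rcases sq_eq_sq_iff_eq_or_eq_neg.1 heq with h | h
      · exact h.symm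
      · rw [h] at hsq
        linarith
    have hmeet : y T = q (T + (t₂ - T)) := by
      rw [add_sub_cancel]
      exact hinj hyT hyT' (hqt t₂ ht₂.1).1 (hqt t₂ ht₂.1).2 heq'
    have hback := hy.eq_zero_of_eq hF (hq.comp_add (sub_nonneg.2 ht₂.1)) hT.le hmeet
    rw [zero_add] at hback
    rcases (sub_nonneg.2 ht₂.1).eq_or_lt with h | h
    · rw [hback, ← h]
    · have := (prodN_strict_of_isForwardSolution hv0 hq le_rfl h (by rwa [← h0])).2
      rw [← hback, h0] at this
      exact absurd this (lt_irrefl _)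
  rintro _ ⟨y, hy, rfl, hylim⟩ _ ⟨q, hq, rfl, hqlim⟩ h
  by_cases hne : prodN (y 0) = 0
  · rw [hzero y hy hylim hne, hzero q hq hqlim (by rw [← h, hne])]
  · obtain ⟨T, hT⟩ := eventually_atTop.1 ((hc.eventually_mem y hy hylim).and
      ((hc.eventually_mem q hq hqlim).and (eventually_gt_atTop 0)))
    obtain ⟨hyT, -, hT0⟩ := hT T le_rfl
    rcases le_total (prodN (y T) ^ 2) (prodN (q T) ^ 2) with hle | hle
    · exact hmerge y q T hy hq hqlim hT0 hyT.1 hyT.2 (fun t ht => (hT t ht).2.1) hne h hle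
    · exact (hmerge q y T hq hy hylim hT0 (hT T le_rfl).2.1.1 (hT T le_rfl).2.1.2
        (fun t ht => (hT t ht).1) (by rwa [← h]) h.symm hle).symm

end Bianchi

/-! ### Charts of a set on which a continuous function is injective -/

section Charts

variable {W : Set Phase} {g : Phase → ℝ} {X : ℝ → Phase} {a b : ℝ}

/-- If `g` is injective on `W` and strictly increasing along a curve in `W`, the curve fills the
part of `W` between the level sets of `g` through its end points. -/
theorem inter_preimage_Ioo_eq_image (hab : a ≤ b) (hgc : Continuous g) (hg : InjOn g W)
    (hX : ContinuousOn X (Icc a b)) (hXW : ∀ t ∈ Icc a b, X t ∈ W)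
    (hmono : StrictMonoOn (fun t => g (X t)) (Icc a b)) :
    W ∩ g ⁻¹' Ioo (g (X a)) (g (X b)) = X '' Ioo a b := by
  have ha : a ∈ Icc a b := ⟨le_rfl, hab⟩
  have hb : b ∈ Icc a b := ⟨hab, le_rfl⟩
  apply Subset.antisymm
  · rintro y ⟨hyW, hy⟩
    obtain ⟨t, ht, hty⟩ := intermediate_value_Ioo hab (hgc.comp_continuousOn hX) hy
    exact ⟨t, ht, hg (hXW t (Ioo_subset_Icc_self ht)) hyW hty⟩
  · rintro _ ⟨t, ht, rfl⟩
    have ht' := Ioo_subset_Icc_self ht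
    exact ⟨hXW t ht', hmono ha ht' ht.1, hmono ht' hb ht.2⟩

theorem isEmbedding_domRestrict_Ioo (hgc : Continuous g) (hX : ContinuousOn X (Ioo a b))
    (hmono : StrictMonoOn (fun t => g (X t)) (Ioo a b)) :
    IsEmbedding ((Ioo a b).domRestrict X) := by
  have hc : Continuous ((Ioo a b).domRestrict X) := continuousOn_iff_continuous_domRestrict.1 hX
  have hs : StrictMono (g ∘ (Ioo a b).domRestrict X) := fun s t hst => hmono s.2 t.2 hst
  refine IsEmbedding.of_comp hc hgc (hs.isEmbedding_of_ordConnected ?_)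
  have : PreconnectedSpace (Ioo a b) := Subtype.preconnectedSpace isPreconnected_Ioo
  exact (isPreconnected_range (hgc.comp hc)).ordConnected

/-- Criterion for an embedded curve: some continuous function is injective on the set, and through
each point there is a regular curve in the set along which the function is strictly monotone. -/
theorem isOneDimSubmanifold_of_injOn (hgc : Continuous g) (hg : InjOn g W)
    (h : ∀ q ∈ W, ∃ (ε : ℝ) (X : ℝ → Phase), 0 < ε ∧ X 0 = q ∧ ContDiffOn ℝ ∞ X (Ioo (-ε) ε) ∧
      (∀ t ∈ Ioo (-ε) ε, deriv X t ≠ 0) ∧ (∀ t ∈ Ioo (-ε) ε, X t ∈ W) ∧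
      (StrictMonoOn (fun t => g (X t)) (Ioo (-ε) ε) ∨
        StrictAntiOn (fun t => g (X t)) (Ioo (-ε) ε))) : IsOneDimSubmanifold W := by
  intro q hq
  obtain ⟨ε, X, hε, rfl, hsm, hd, hXW, hmono⟩ := h q hq
  -- replacing `g` by `-g` reduces to the increasing case
  obtain ⟨g, hgc, hg, hmono⟩ : ∃ g : Phase → ℝ, Continuous g ∧ InjOn g W ∧
      StrictMonoOn (fun t => g (X t)) (Ioo (-ε) ε) := by
    rcases hmono with hmono | hmono
    · exact ⟨g, hgc, hg, hmono⟩
    · exact ⟨fun x => -g x, hgc.neg, fun x hx y hy hxy => hg hx hy (neg_injective hxy),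
        fun s hs t ht hst => neg_lt_neg (hmono hs ht hst)⟩
  have hscale : ∀ t ∈ Icc (-1 : ℝ) 1, ε / 2 * t ∈ Ioo (-ε) ε := fun t ht =>
    ⟨by nlinarith [ht.1], by nlinarith [ht.2]⟩
  set c : ℝ → Phase := fun t => X (ε / 2 * t) with hc
  have hcc : ContinuousOn c (Icc (-1) 1) :=
    hsm.continuousOn.comp (continuous_const.mul continuous_id).continuousOn hscale
  have hcm : StrictMonoOn (fun t => g (c t)) (Icc (-1) 1) := fun s hs t ht hst =>
    hmono (hscale s hs) (hscale t ht) (by gcongr)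
  have hcW : ∀ t ∈ Icc (-1 : ℝ) 1, c t ∈ W := fun t ht => hXW _ (hscale t ht)
  have h0 : (0 : ℝ) ∈ Icc (-1 : ℝ) 1 := by simp
  have hc0 : c 0 = X 0 := by simp [hc]
  refine ⟨g ⁻¹' Ioo (g (c (-1))) (g (c 1)), isOpen_Ioo.preimage hgc, ?_, c, ?_, ?_,
    isEmbedding_domRestrict_Ioo hgc (hcc.mono Ioo_subset_Icc_self) (hcm.mono Ioo_subset_Icc_self),
    (inter_preimage_Ioo_eq_image (by norm_num) hgc hg hcc hcW hcm).symm⟩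
  · rw [← hc0]
    exact ⟨hcm (by simp) h0 (by norm_num), hcm h0 (by simp) (by norm_num)⟩
  · exact hsm.comp (contDiff_const.mul contDiff_id).contDiffOn
      fun t ht => hscale t (Ioo_subset_Icc_self ht)
  · intro t ht
    have ht' := hscale t (Ioo_subset_Icc_self ht)
    have h1 := ((hsm.contDiffAt (isOpen_Ioo.mem_nhds ht')).differentiableAt (by simp)).hasDerivAt
    have h2 := HasDerivAt.scomp (g₁ := X) t h1 ((hasDerivAt_id t).const_mul (ε / 2))
    have h3 : deriv c t = (ε / 2 * 1) • deriv X (ε / 2 * t) := h2.deriv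
    rw [h3]
    exact smul_ne_zero (by positivity) (hd _ ht')

end Charts

/-! ### Smooth solutions and Taylor expansion -/

/-- A solution of an autonomous equation with smooth right-hand side is smooth. -/
theorem contDiffOn_of_hasDerivAt {E : Type*} [NormedAddCommGroup E] [NormedSpace ℝ E] {F : E → E}
    (hF : ContDiff ℝ ∞ F) {X : ℝ → E} {U : Set ℝ} (hU : IsOpen U)
    (hX : ∀ t ∈ U, HasDerivAt X (F (X t)) t) : ContDiffOn ℝ ∞ X U := by
  rw [contDiffOn_infty]
  intro n
  induction n with
  | zero =>
    exact contDiffOn_zero.2 fun t ht => (hX t ht).continuousAt.continuousWithinAt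
  | succ n ih =>
    have h : ((n + 1 : ℕ) : WithTop ℕ∞) = (n : WithTop ℕ∞) + 1 := by push_cast; rfl
    rw [h, contDiffOn_succ_iff_deriv_of_isOpen hU]
    refine ⟨fun t ht => (hX t ht).differentiableAt.differentiableWithinAt, by simp, ?_⟩
    exact ((hF.of_le (mod_cast le_top)).comp_contDiffOn ih).congr fun t ht => (hX t ht).deriv

/-- A `C^∞` function agrees with its linearization up to a quadratic error. -/
theorem isBigO_sub_linear_of_contDiffAt {f : ℝ → ℝ} {a : ℝ} (hf : ContDiffAt ℝ ∞ f 0)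
    (hd : HasDerivAt f a 0) : (fun s => f s - (f 0 + a * s)) =O[𝓝 0] fun s => s ^ 2 := by
  have hf' : DifferentiableAt ℝ (deriv f) 0 :=
    (hf.derivWithin (m := 1) (by norm_cast)).differentiableAt one_ne_zero
  have h1 := hf'.hasDerivAt.isBigO_sub
  simp only [hd.deriv, sub_zero] at h1
  obtain ⟨C, hC0, hC⟩ := h1.exists_nonneg
  have hdiff : ∀ᶠ s in 𝓝 (0 : ℝ), DifferentiableAt ℝ f s := by
    have := (hf.of_le (show (1 : WithTop ℕ∞) ≤ ∞ by norm_cast)).eventually (by simp)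
    filter_upwards [this] with s hs using hs.differentiableAt one_ne_zero
  obtain ⟨ρ, hρ, hball⟩ := Metric.eventually_nhds_iff_ball.1 (hC.bound.and hdiff)
  refine IsBigO.of_bound C ?_
  filter_upwards [Metric.ball_mem_nhds (0 : ℝ) hρ] with s hs
  have hs' : |s| < ρ := by simpa using hs
  -- mean value inequality on the ball of radius `|s|`
  have hmv := (convex_closedBall (0 : ℝ) |s|).norm_image_sub_le_of_norm_hasDerivWithin_le
    (f := fun u => f u - a * u) (f' := fun u => deriv f u - a) (C := C * |s|) (x := 0) (y := s)
    (fun u hu => by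
      have hu' : u ∈ Metric.ball (0 : ℝ) ρ := by
        rw [mem_ball_zero_iff]
        exact (mem_closedBall_zero_iff.1 hu).trans_lt hs'
      refine HasDerivAt.hasDerivWithinAt ?_
      exact ((hball u hu').2.hasDerivAt.sub ((hasDerivAt_id u).const_mul a)).congr_deriv
        (by rw [mul_one]))
    (fun u hu => by
      have hu1 : ‖u‖ ≤ |s| := mem_closedBall_zero_iff.1 hu
      have hu' : u ∈ Metric.ball (0 : ℝ) ρ := by
        rw [mem_ball_zero_iff]
        exact hu1.trans_lt hs'
      exact (hball u hu').1.trans (by gcongr))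
    (by simp) (by simp)
  rw [norm_pow, Real.norm_eq_abs s, pow_two, ← mul_assoc]
  simpa [sub_sub, add_comm, Real.norm_eq_abs, sub_eq_add_neg, add_assoc] using hmv

namespace Bianchi

/-! ### Charts of the stable set -/

variable {v : ℝ}

/-- A constrained forward solution extends to a smooth constrained solution for small negative
times. -/
theorem exists_backward_extension {x : ℝ → Phase}
    (hx : IsForwardSolution (field v) constraintSet x) :
    ∃ (ε : ℝ) (Z : ℝ → Phase), 0 < ε ∧ (∀ t, 0 ≤ t → Z t = x t) ∧
      ∀ t, -ε < t → HasDerivAt Z (field v (Z t)) t ∧ Z t ∈ constraintSet := by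
  obtain ⟨r, hr, ε, hε, H⟩ := ((contDiff_field v).contDiffAt (x := x 0)).of_le
    (show (1 : WithTop ℕ∞) ≤ ∞ by norm_cast)
    |>.exists_forall_mem_closedBall_exists_eq_forall_mem_Ioo_hasDerivAt 0
  obtain ⟨X, hX0, hX⟩ := H (x 0) (Metric.mem_closedBall_self hr.le)
  rw [zero_sub, zero_add] at hX
  set Z : ℝ → Phase := fun t => if t ≤ 0 then X t else x t with hZ
  have hZx : ∀ t, 0 ≤ t → Z t = x t := by
    intro t ht
    rcases ht.eq_or_lt with rfl | ht
    · simp [hZ, hX0]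
    · simp [hZ, not_le.2 ht]
  have hZX : ∀ t, t ≤ 0 → Z t = X t := fun t ht => by simp [hZ, ht]
  have hder : ∀ t, -ε < t → HasDerivAt Z (field v (Z t)) t := by
    intro t ht
    have hl : t ≤ 0 → HasDerivWithinAt Z (field v (Z t)) (Iic 0) t := fun h => by
      rw [hZX t h]
      exact (hX t ⟨ht, by linarith⟩).hasDerivWithinAt.congr (fun u hu => hZX u hu) (hZX t h)
    have hr : 0 ≤ t → HasDerivWithinAt Z (field v (Z t)) (Ici 0) t := fun h => by
      rw [hZx t h]
      exact (hx t h).1.congr (fun u hu => hZx u hu) (hZx t h)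
    rcases lt_trichotomy t 0 with h | h | h
    · exact (hl h.le).hasDerivAt (Iic_mem_nhds h)
    · have := (hl h.le).union (hr h.ge)
      rwa [Iic_union_Ici, hasDerivWithinAt_univ] at this
    · exact (hr h.le).hasDerivAt (Ici_mem_nhds h)
  refine ⟨ε, Z, hε, hZx, fun t ht => ⟨hder t ht, ?_⟩⟩
  rcases le_total 0 t with h | h
  · rw [hZx t h]
    exact (hx t h).2
  · have hmem : ∀ u ∈ Icc t 0, -ε < u := fun u hu => ht.trans_le hu.1
    have hσ : Continuous sigmaSq := by unfold sigmaSq; fun_prop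
    rw [mem_constraintSet_iff]
    refine eq_zero_of_linear_of_eq_zero_right (γ := fun u => defect (Z u))
      (m := fun u => -(8 * v * sigmaSq (Z u))) (b := 0) ?_ (fun u hu => ?_) ?_ t ⟨le_rfl, h⟩
    · have hZc : ContinuousOn Z (Icc t 0) := fun u hu =>
        (hder u (hmem u hu)).continuousAt.continuousWithinAt
      exact ((hσ.comp_continuousOn hZc).const_smul (8 * v)).neg
    · rw [← fderiv_defect_field]
      exact (hasDerivAt_comp_of_contDiff contDiff_defect (hder u (hmem u hu))).hasDerivWithinAt
    · rw [hZx 0 le_rfl]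
      exact mem_constraintSet_iff.1 (hx 0 le_rfl).2

/-- A constrained solution on which `N₁ N₂ N₃` does not vanish provides a chart of the stable set
around its initial value. -/
theorem exists_chart_of_prodN_ne_zero (hv : v ∈ Ioo (1 / 2 : ℝ) 1) {q : Phase}
    (hq : q ∈ stableSet (field v) constraintSet (pVI v)) (hne : prodN q ≠ 0) :
    ∃ (ε : ℝ) (X : ℝ → Phase), 0 < ε ∧ X 0 = q ∧ ContDiffOn ℝ ∞ X (Ioo (-ε) ε) ∧
      (∀ t ∈ Ioo (-ε) ε, deriv X t ≠ 0) ∧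
      (∀ t ∈ Ioo (-ε) ε, X t ∈ stableSet (field v) constraintSet (pVI v)) ∧
      (StrictMonoOn (fun t => prodN (X t)) (Ioo (-ε) ε) ∨
        StrictAntiOn (fun t => prodN (X t)) (Ioo (-ε) ε)) := by
  have hv0 := pos_of_mem hv
  obtain ⟨x, hx, rfl, hlim⟩ := hq
  obtain ⟨ε₀, Z, hε₀, hZx, hZ⟩ := exists_backward_extension hx
  -- shrink the interval so that `N₁ N₂ N₃` keeps its sign
  have hZ0 : Z 0 = x 0 := hZx 0 le_rfl
  have hcont : ContinuousAt (fun t => prodN (Z 0) * prodN (Z t)) 0 :=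
    (contDiff_prodN.continuous.continuousAt.comp (hZ 0 (by linarith)).1.continuousAt).const_smul
      (prodN (Z 0))
  have hpos : 0 < prodN (Z 0) * prodN (Z 0) := by
    rw [hZ0]
    exact mul_self_pos.2 hne
  obtain ⟨ρ, hρ, hρ'⟩ := Metric.eventually_nhds_iff.1 (hcont.eventually_const_lt hpos)
  have hmin : 0 < min ε₀ ρ := lt_min hε₀ hρ
  have hI : ∀ t ∈ Ioo (-(min ε₀ ρ)) (min ε₀ ρ), -ε₀ < t ∧ 0 < prodN (Z 0) * prodN (Z t) := by
    intro t ht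
    refine ⟨by linarith [ht.1, min_le_left ε₀ ρ], hρ' ?_⟩
    rw [Real.dist_eq, sub_zero]
    exact (abs_lt.2 ht).trans_le (min_le_right _ _)
  have hfwd : ∀ t ∈ Ioo (-(min ε₀ ρ)) (min ε₀ ρ),
      IsForwardSolution (field v) constraintSet fun u => Z (u + t) := by
    intro t ht u hu
    have h1 := hZ (u + t) (by linarith [(hI t ht).1])
    exact ⟨(h1.1.comp_add_const u t).hasDerivWithinAt, h1.2⟩
  have hZlim : Tendsto Z atTop (𝓝 (pVI v)) :=
    hlim.congr' (by filter_upwards [eventually_ge_atTop 0] with t ht using (hZx t ht).symm)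
  refine ⟨min ε₀ ρ, Z, hmin, hZ0, ?_, ?_, ?_, ?_⟩
  · exact contDiffOn_of_hasDerivAt (contDiff_field v) isOpen_Ioo fun t ht => (hZ t (hI t ht).1).1
  · intro t ht h0
    rw [(hZ t (hI t ht).1).1.deriv] at h0
    -- a zero of the field would be an equilibrium, along which `N₁ N₂ N₃` is constant
    have := (prodN_strict_of_isForwardSolution hv0
      (isForwardSolution_const h0 (hZ t (hI t ht).1).2) le_rfl one_pos
      (right_ne_zero_of_mul (hI t ht).2.ne')).2
    exact lt_irrefl _ this
  · intro t ht
    exact ⟨_, hfwd t ht, by simp, hZlim.comp (tendsto_atTop_add_const_right _ _ tendsto_id)⟩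
  · have hsq : ∀ s ∈ Ioo (-(min ε₀ ρ)) (min ε₀ ρ), ∀ t ∈ Ioo (-(min ε₀ ρ)) (min ε₀ ρ), s < t →
        prodN (Z t) ^ 2 < prodN (Z s) ^ 2 := by
      intro s hs t _ hst
      have := (prodN_strict_of_isForwardSolution hv0 (hfwd s hs) le_rfl (sub_pos.2 hst)
        (by simpa using right_ne_zero_of_mul (hI s hs).2.ne')).2
      simpa using this
    rcases lt_or_gt_of_ne (left_ne_zero_of_mul hpos.ne') with h | h
    · left
      intro s hs t ht hst
      have h1 := (hI s hs).2
      have h2 := (hI t ht).2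
      have h3 := hsq s hs t ht hst
      have h4 : prodN (Z s) < 0 := by nlinarith
      have h5 : prodN (Z t) < 0 := by nlinarith
      beta_reduce
      nlinarith
    · right
      intro s hs t ht hst
      have h1 := (hI s hs).2
      have h2 := (hI t ht).2
      have h3 := hsq s hs t ht hst
      have h4 : 0 < prodN (Z s) := by nlinarith
      have h5 : 0 < prodN (Z t) := by nlinarith
      beta_reduce
      nlinarith

/-- The local stable curve as the graph required near the equilibrium. -/
theorem IsLocalStableCurve.exists_graph (hv : v ∈ Ioo (1 / 2 : ℝ) 1) {δ : ℝ} {c : ℝ → Phase}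
    (hc : IsLocalStableCurve v δ c) :
    ∃ δ : ℝ, 0 < δ ∧ ∃ U : Set Phase, IsOpen U ∧ pVI v ∈ U ∧
      ContDiffOn ℝ ∞ c (Ioo (-δ) δ) ∧ (∀ s ∈ Ioo (-δ) δ, c s 1 = s) ∧
      stableSet (field v) constraintSet (pVI v) ∩ U = c '' Ioo (-δ) δ := by
  have hδ := hc.pos
  have hsub : Icc (-(δ / 2)) (δ / 2) ⊆ Ioo (-δ) δ := fun s hs =>
    ⟨by linarith [hs.1], by linarith [hs.2]⟩
  have hsub' : Ioo (-(δ / 2)) (δ / 2) ⊆ Ioo (-δ) δ := Ioo_subset_Icc_self.trans hsub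
  have hgc : Continuous fun x : Phase => -prodN x := contDiff_prodN.continuous.neg
  have hmono : StrictMonoOn (fun s => -prodN (c s)) (Icc (-(δ / 2)) (δ / 2)) :=
    fun s hs t ht hst => neg_lt_neg (hc.strictAntiOn (hsub hs) (hsub ht) hst)
  have h0 : (0 : ℝ) ∈ Icc (-(δ / 2)) (δ / 2) := ⟨by linarith, by linarith⟩
  refine ⟨δ / 2, by positivity, _, isOpen_Ioo.preimage hgc, ?_, hc.contDiffOn.mono hsub',
    fun s hs => hc.coord_one s (hsub' hs),
    inter_preimage_Ioo_eq_image (by linarith) hgc (fun x hx y hy hxy =>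
      hc.injOn_prodN hv hx hy (neg_injective hxy)) (hc.contDiffOn.continuousOn.mono hsub)
      (fun s hs => ?_) hmono⟩
  · rw [← hc.map_zero]
    exact ⟨hmono ⟨le_rfl, by linarith⟩ h0 (by linarith),
      hmono h0 ⟨by linarith, le_rfl⟩ (by linarith)⟩
  · rw [← hc.Wss_eq_stableSet hv]
    exact hc.mem_strongStableSet s (hsub hs)

theorem IsLocalStableCurve.isOneDimSubmanifold (hv : v ∈ Ioo (1 / 2 : ℝ) 1) {δ : ℝ}
    {c : ℝ → Phase} (hc : IsLocalStableCurve v δ c) :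
    IsOneDimSubmanifold (stableSet (field v) constraintSet (pVI v)) := by
  have hinj := hc.injOn_prodN hv
  refine isOneDimSubmanifold_of_injOn contDiff_prodN.continuous hinj fun q hq => ?_
  by_cases hne : prodN q = 0
  · have hmem : ∀ s ∈ Ioo (-δ) δ, c s ∈ stableSet (field v) constraintSet (pVI v) := fun s hs => by
      rw [← hc.Wss_eq_stableSet hv]
      exact hc.mem_strongStableSet s hs
    have h0 : (0 : ℝ) ∈ Ioo (-δ) δ := ⟨by linarith [hc.pos], hc.pos⟩
    refine ⟨δ, c, hc.pos, hinj (hmem 0 h0) hq ?_, hc.contDiffOn, fun s hs hd => ?_, hmem,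
      Or.inr hc.strictAntiOn⟩
    · rw [hne, hc.map_zero, prodN_pVI]
    · -- the `Σ₋`-component of the derivative is `1`
      have h1 : HasDerivAt (fun s => c s 1) (deriv c s 1) s :=
        hasDerivAt_pi.1 ((hc.contDiffOn.contDiffAt
          (isOpen_Ioo.mem_nhds hs)).differentiableAt (by simp)).hasDerivAt 1
      have h2 : HasDerivAt (fun s => c s 1) 1 s := (hasDerivAt_id s).congr_of_eventuallyEq (by
        filter_upwards [isOpen_Ioo.mem_nhds hs] with t ht using hc.coord_one t ht)
      have := h1.unique h2
      rw [hd] at this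
      exact zero_ne_one this
  · exact exists_chart_of_prodN_ne_zero hv hq hne

end Bianchi

theorem mainTheorem5 (v : ℝ) (hv : v ∈ Ioo (1 / 2 : ℝ) 1) :
    -- `pVI v` is an equilibrium of the constrained system
    (Bianchi.field v (Bianchi.pVI v) = 0 ∧ Bianchi.pVI v ∈ Bianchi.constraintSet) ∧
    -- `eSS v` is an eigenvector of the linearization with eigenvalue `-3/v`
    Module.End.HasEigenvector
      (fderiv ℝ (Bianchi.field v) (Bianchi.pVI v) : Phase →ₗ[ℝ] Phase)
      (Bianchi.lamSS v) (Bianchi.eSS v) ∧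
    -- the strong-stable manifold is one-dimensional
    IsOneDimSubmanifold (Bianchi.Wss v) ∧
    -- it contains every constrained solution that converges to the equilibrium
    Bianchi.Wss v = stableSet (Bianchi.field v) Bianchi.constraintSet (Bianchi.pVI v) ∧
    -- near the equilibrium it is a smooth graph over `Σ₋`, tangent to `eSS v`,
    -- with the first-order expansion below
    ∃ δ : ℝ, 0 < δ ∧ ∃ U : Set Phase, IsOpen U ∧ Bianchi.pVI v ∈ U ∧
      ∃ sp n₁ n₂ n₃ : ℝ → ℝ,
        ContDiffOn ℝ ∞ sp (Ioo (-δ) δ) ∧ ContDiffOn ℝ ∞ n₁ (Ioo (-δ) δ) ∧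
        ContDiffOn ℝ ∞ n₂ (Ioo (-δ) δ) ∧ ContDiffOn ℝ ∞ n₃ (Ioo (-δ) δ) ∧
        Bianchi.Wss v ∩ U = (fun s : ℝ => ![sp s, s, n₁ s, n₂ s, n₃ s]) '' Ioo (-δ) δ ∧
        ![sp 0, 0, n₁ 0, n₂ 0, n₃ 0] = Bianchi.pVI v ∧
        HasDerivAt (fun s : ℝ => (![sp s, s, n₁ s, n₂ s, n₃ s] : Phase)) (Bianchi.eSS v) 0 ∧
        (fun s : ℝ => sp s - (-(1 / (2 * v)) + 0 * s)) =O[𝓝 0] (fun s : ℝ => s ^ 2) ∧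
        (fun s : ℝ => n₁ s - (0 + (8 * v ^ 2 + 1) / √(3 * (4 * v ^ 2 - 1)) * s))
          =O[𝓝 0] (fun s : ℝ => s ^ 2) ∧
        (fun s : ℝ => n₂ s - (√(4 * v ^ 2 - 1) / (4 * v) + √(3 * (4 * v ^ 2 - 1)) / 6 * s))
          =O[𝓝 0] (fun s : ℝ => s ^ 2) ∧
        (fun s : ℝ => n₃ s - (-(√(4 * v ^ 2 - 1) / (4 * v)) + √(3 * (4 * v ^ 2 - 1)) / 6 * s))
          =O[𝓝 0] (fun s : ℝ => s ^ 2) := by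
  obtain ⟨δ₀, c, hc⟩ := Bianchi.exists_isLocalStableCurve hv
  have hW := hc.Wss_eq_stableSet hv
  refine ⟨⟨Bianchi.field_pVI hv, Bianchi.pVI_mem_constraintSet hv⟩, Bianchi.hasEigenvector_eSS hv,
    by rw [hW]; exact hc.isOneDimSubmanifold hv, hW, ?_⟩
  obtain ⟨δ, hδ, U, hU, hpU, hsm, hc1, hWU⟩ := hc.exists_graph hv
  have h0 : (0 : ℝ) ∈ Ioo (-δ) δ := ⟨by linarith, hδ⟩
  have hcomp : ∀ i, ContDiffOn ℝ ∞ (fun s => c s i) (Ioo (-δ) δ) := contDiffOn_pi.1 hsm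
  have hvec : ∀ s, c s 1 = s → ![c s 0, s, c s 2, c s 3, c s 4] = c s := by
    intro s hs
    ext i
    fin_cases i <;> simp [hs]
  have hO : ∀ i, (fun s => c s i - (Bianchi.pVI v i + Bianchi.eSS v i * s)) =O[𝓝 0]
      fun s => s ^ 2 := by
    intro i
    have := isBigO_sub_linear_of_contDiffAt ((hcomp i).contDiffAt (isOpen_Ioo.mem_nhds h0))
      (hasDerivAt_pi.1 hc.hasDerivAt_zero i)
    rwa [hc.map_zero] at this
  refine ⟨δ, hδ, U, hU, hpU, fun s => c s 0, fun s => c s 2, fun s => c s 3, fun s => c s 4,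
    hcomp 0, hcomp 2, hcomp 3, hcomp 4, ?_, ?_, ?_, ?_, ?_, ?_, ?_⟩
  · rw [hW, hWU]
    exact image_congr fun s hs => (hvec s (hc1 s hs)).symm
  · rw [← hc.map_zero]
    exact hvec 0 (hc1 0 h0)
  · refine hc.hasDerivAt_zero.congr_of_eventuallyEq ?_
    filter_upwards [isOpen_Ioo.mem_nhds h0] with s hs using hvec s (hc1 s hs)
  · exact hO 0
  · exact hO 2
  · exact hO 3
  · exact hO 4
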